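/- **Bounds on CATE and ATE under conditional $c$-dependence.** Let $X\in\{0,1\}$ be a treatment, $Y_1,Y_0$ real potential outcomes, $W$ a random vector in $\mathbb{R}^K$, and $Y=XY_1+(1-X)Y_0$ the observed outcome. Fix a regular conditional distribution of $(Y_1,Y_0,X)$ given $W$; all statements conditional on $W=w$ refer to it. Write $p_{x\mid w}=P(X=x\mid W=w)$, and let $c\in[0,1]$. The maintained assumptions are, for all $w\in\operatorname{supp}(W)$ and $x,x'\in\{0,1\}$: (A1) the cdf of $Y_x\mid X=x',W=w$ is continuous, and strictly increasing on its support; $\operatorname{supp}(Y_x\mid X=x',W=w)=\operatorname{supp}(Y_x\mid W=w)=[\underline y_x(w),\overline y_x(w)]$ (intersected with $\mathbb{R}$) with $-\infty\le\underline y_x(w)<\overline y_x(w)\le\infty$; and $p_{1\mid w}\in(0,1)$; (A2) $\sup_{y\in\operatorname{supp}(Y_x\mid W=w)}|P(X=1\mid Y_x=y,W=w)-p_{1\mid w}|\le c$ for some version of the conditional probability given $Y_x=y$. Let $Q_{Y\mid X,W}(\cdot\mid x,w):[0,1]\to[-\infty,\infty]$ be the left inverse of the cdf of $Y\mid X=x,W=w$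 on its support, so that its values at $0$ and $1$ are the endpoints of the support. For $\tau\in(0,1)$ put $$\overline Q{}^c_x(\tau\mid w)=Q_{Y\mid X,W}\Big(\min\Big\{\tau+\tfrac{c}{p_{x\mid w}}\min\{\tau,1-\tau\},\tfrac{\tau}{p_{x\mid w}},1\Big\}\,\Big|\,x,w\Big),$$ $$\underline Q{}^c_x(\tau\mid w)=Q_{Y\mid X,W}\Big(\max\Big\{\tau-\tfrac{c}{p_{x\mid w}}\min\{\tau,1-\tau\},\tfrac{\tau-1}{p_{x\mid w}}+1,0\Big\}\,\Big|\,x,w\Big),$$ $$\underline{\mathrm{CQTE}}^c(\tau\mid w)=\underline Q{}^c_1(\tau\mid w)-\overline Q{}^c_0(\tau\mid w),\qquad \overline{\mathrm{CQTE}}^c(\tau\mid w)=\overline Q{}^c_1(\tau\mid w)-\underline Q{}^c_0(\tau\mid w).$$ A population is *compatible with the observed data* if it satisfies the maintained assumptions, has the same law of $W$, and has the same conditional law of $(Y,X)$ given $W=w$ for every $w\in\operatorname{supp}(W)$. All means below are taken in $[-\infty,\infty]$. Suppose the maintained assumptions hold and $E(|Y|\mid X=x,W=w)<\infty$ for all $x\in\{0,1\}$,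 $w\in\operatorname{supp}(W)$. 1. For every $w\in\operatorname{supp}(W)$ the integrals $$\underline{\mathrm{CATE}}^c(w)=\int_0^1\underline{\mathrm{CQTE}}^c(\tau\mid w)\,d\tau,\qquad \overline{\mathrm{CATE}}^c(w)=\int_0^1\overline{\mathrm{CQTE}}^c(\tau\mid w)\,d\tau$$ exist in $[-\infty,\infty]$, and $\mathrm{CATE}(w)=E(Y_1\mid W=w)-E(Y_0\mid W=w)$, if well defined in $[-\infty,\infty]$, lies in $[\underline{\mathrm{CATE}}^c(w),\overline{\mathrm{CATE}}^c(w)]$. The interior is sharp: every $e$ with $\underline{\mathrm{CATE}}^c(w)<e<\overline{\mathrm{CATE}}^c(w)$ is the value of $\mathrm{CATE}(w)$ in some population compatible with the observed data. 2. If moreover $E[E(|Y|\mid X=x,W)]<\infty$ for $x\in\{0,1\}$, then $\underline{\mathrm{ATE}}^c=E[\underline{\mathrm{CATE}}^c(W)]$ and $\overline{\mathrm{ATE}}^c=E[\overline{\mathrm{CATE}}^c(W)]$ exist in $[-\infty,\infty]$, and $\mathrm{ATE}=E(Y_1-Y_0)$, if it exists in $[-\infty,\infty]$, lies in $[\underline{\mathrm{ATE}}^c,\overline{\mathrm{ATE}}^c]$.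 The interior is sharp: every $e$ with $\underline{\mathrm{ATE}}^c<e<\overline{\mathrm{ATE}}^c$ is the value of $\mathrm{ATE}$ in some population compatible with the observed data. -/

import Mathlib

open MeasureTheory ProbabilityTheory Set
open scoped ENNReal

namespace SensitivityBounds

/-! ### Extended-real expectations -/

/-- `f` has a mean in `[-∞, ∞]`: it is measurable and its positive and negative parts do not both
have infinite integral. -/
def ExtMeanExists {α : Type*} [MeasurableSpace α] (μ : Measure α) (f : α → EReal) : Prop :=
  AEMeasurable f μ ∧
    (∫⁻ a, (f a).toENNReal ∂μ ≠ ⊤ ∨ ∫⁻ a, (-f a).toENNReal ∂μ ≠ ⊤)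

/-- The mean `∫ f⁺ dμ - ∫ f⁻ dμ ∈ [-∞, ∞]`; meaningful when `ExtMeanExists μ f`. -/
noncomputable def extMean {α : Type*} [MeasurableSpace α] (μ : Measure α) (f : α → EReal) :
    EReal :=
  ((∫⁻ a, (f a).toENNReal ∂μ : ℝ≥0∞) : EReal) - ((∫⁻ a, (-f a).toENNReal ∂μ : ℝ≥0∞) : EReal)

/-! ### Potential outcomes, treatment, observed data

Treatment values are Booleans (`true` is `1`, `false` is `0`).  A point `ω : Latent` carries the
potential outcomes `Y_x = ω.1 x` and the treatment `X = ω.2`.  In this part `ν` is the conditional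
law of `(Y_1, Y_0, X)` given `W = w` at a fixed `w`. -/

abbrev Latent : Type := (Bool → ℝ) × Bool

/-- The observed pair `(Y, X)`, with `Y = X Y_1 + (1 - X) Y_0`. -/
def observe (ω : Latent) : ℝ × Bool :=
  (if ω.2 = true then ω.1 true else ω.1 false, ω.2)

/-- The conditional law of `(Y, X)` given `W = w`. -/
noncomputable def obsLaw (ν : Measure Latent) : Measure (ℝ × Bool) := ν.map observe

/-- The law of `Y_x` given `W = w`. -/
noncomputable def potLaw (ν : Measure Latent) (x : Bool) : Measure ℝ :=
  ν.map (fun ω => ω.1 x)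

/-- The law of `Y_x` given `X = x', W = w`. -/
noncomputable def potLawGiven (ν : Measure Latent) (x x' : Bool) : Measure ℝ :=
  (ν[|{ω : Latent | ω.2 = x'}]).map (fun ω => ω.1 x)

/-- Continuity, common interval support and overlap, at a given `w`. -/
structure RegularAt (ν : Measure Latent) : Prop where
  continuous_cdf : ∀ x x' : Bool, Continuous (cdf (potLawGiven ν x x'))
  strictMonoOn_cdf : ∀ x x' : Bool,
    StrictMonoOn (cdf (potLawGiven ν x x')) (potLawGiven ν x x').support
  support_eq : ∀ x : Bool, ∃ a b : EReal, a < b ∧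
    (potLaw ν x).support = {y : ℝ | a ≤ (y : EReal) ∧ (y : EReal) ≤ b} ∧
    ∀ x' : Bool, (potLawGiven ν x x').support = (potLaw ν x).support
  overlap : ν.real {ω : Latent | ω.2 = true} ∈ Ioo (0 : ℝ) 1

/-- `X` is conditionally `c`-dependent with `Y_x` given `W = w`: for a version
`y ↦ P(X = · | Y_x = y, W = w)` of the conditional distribution of `X` given `Y_x`,
`|P(X = 1 | Y_x = y, W = w) - P(X = 1 | W = w)| ≤ c` at all `y` in the support of `Y_x | W = w`. -/
def CDependentAt (c : ℝ) (ν : Measure Latent) (x : Bool) : Prop :=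
  ∃ π : Kernel ℝ Bool, IsMarkovKernel π ∧
    (potLaw ν x).compProd π = ν.map (fun ω : Latent => (ω.1 x, ω.2)) ∧
    ∀ y ∈ (potLaw ν x).support,
      |(π y).real {true} - ν.real {ω : Latent | ω.2 = true}| ≤ c

/-- `E(Y_x | W = w)`, as an extended real. -/
noncomputable def potMean (ν : Measure Latent) (x : Bool) : EReal :=
  extMean ν (fun ω => ((ω.1 x : ℝ) : EReal))

/-- `CATE(w) = E(Y_1 | W = w) - E(Y_0 | W = w)`. -/
noncomputable def cate (ν : Measure Latent) : EReal := potMean ν true - potMean ν false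

/-- `CATE(w)` is well defined in `[-∞, ∞]`: both means exist and their difference is neither
`∞ - ∞` nor `(-∞) - (-∞)`. -/
def CateExists (ν : Measure Latent) : Prop :=
  (∀ x : Bool, ExtMeanExists ν (fun ω => ((ω.1 x : ℝ) : EReal))) ∧
    ¬ (potMean ν true = ⊤ ∧ potMean ν false = ⊤) ∧
    ¬ (potMean ν true = ⊥ ∧ potMean ν false = ⊥)

/-! ### Bounds computed from the observed data

In this part `q` is the conditional law of `(Y, X)` given `W = w`. -/

/-- `p_{x|w} = P(X = x | W = w)`. -/
noncomputable def propensity (q : Measure (ℝ × Bool)) (x : Bool) : ℝ :=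
  q.real {o : ℝ × Bool | o.2 = x}

/-- The law of `Y` given `X = x, W = w`. -/
noncomputable def outcomeLaw (q : Measure (ℝ × Bool)) (x : Bool) : Measure ℝ :=
  (q[|{o : ℝ × Bool | o.2 = x}]).map Prod.fst

/-- The quantile function of a law on `ℝ`: the left inverse of its cdf on its support, so that its
values at `0` and `1` are the (possibly infinite) infimum and supremum of an interval support. -/
noncomputable def quantile (ρ : Measure ℝ) (u : ℝ) : EReal :=
  sInf ((fun y : ℝ => (y : EReal)) '' {y : ℝ | y ∈ ρ.support ∧ u ≤ cdf ρ y})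

noncomputable def quantileUpper (c : ℝ) (q : Measure (ℝ × Bool)) (x : Bool) (τ : ℝ) : EReal :=
  quantile (outcomeLaw q x)
    (min (min (τ + c / propensity q x * min τ (1 - τ)) (τ / propensity q x)) 1)

noncomputable def quantileLower (c : ℝ) (q : Measure (ℝ × Bool)) (x : Bool) (τ : ℝ) : EReal :=
  quantile (outcomeLaw q x)
    (max (max (τ - c / propensity q x * min τ (1 - τ)) ((τ - 1) / propensity q x + 1)) 0)

noncomputable def cqteLower (c : ℝ) (q : Measure (ℝ × Bool)) (τ : ℝ) : EReal :=
  quantileLower c q true τ - quantileUpper c q false τ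

noncomputable def cqteUpper (c : ℝ) (q : Measure (ℝ × Bool)) (τ : ℝ) : EReal :=
  quantileUpper c q true τ - quantileLower c q false τ

noncomputable def cateLower (c : ℝ) (q : Measure (ℝ × Bool)) : EReal :=
  extMean (volume.restrict (Ioo (0 : ℝ) 1)) (cqteLower c q)

noncomputable def cateUpper (c : ℝ) (q : Measure (ℝ × Bool)) : EReal :=
  extMean (volume.restrict (Ioo (0 : ℝ) 1)) (cqteUpper c q)

/-! ### The population and identified sets

The law of `(W, (Y_1, Y_0, X))` is `μ ⊗ₘ κ`, where `μ` is the law of `W` and `κ w` is the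
conditional law of `(Y_1, Y_0, X)` given `W = w`.  `Q w` is the conditional law of `(Y, X)` given
`W = w`; the law of the observables `(Y, X, W)` is thus described by `μ` and `Q`. -/

/-- The maintained assumptions: at every `w` in the support of `W`, the regularity conditions hold
and `X` is conditionally `c`-dependent with `Y_1` and with `Y_0`. -/
def MaintainedAssumptions {K : ℕ} (c : ℝ) (μ : Measure (Fin K → ℝ))
    (κ : Kernel (Fin K → ℝ) Latent) : Prop :=
  ∀ w ∈ μ.support, RegularAt (κ w) ∧ ∀ x : Bool, CDependentAt c (κ w) x

/-- `κ` is the latent part of a population with covariate law `μ` that satisfies the maintained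
assumptions and generates the observed conditional laws `Q`. -/
def Compatible {K : ℕ} (c : ℝ) (μ : Measure (Fin K → ℝ)) (Q : (Fin K → ℝ) → Measure (ℝ × Bool))
    (κ : Kernel (Fin K → ℝ) Latent) : Prop :=
  IsMarkovKernel κ ∧ MaintainedAssumptions c μ κ ∧ ∀ w ∈ μ.support, obsLaw (κ w) = Q w

/-- The values of `CATE(w)` attained by populations compatible with the observed data. -/
def cateIdentifiedSet {K : ℕ} (c : ℝ) (μ : Measure (Fin K → ℝ))
    (Q : (Fin K → ℝ) → Measure (ℝ × Bool)) (w : Fin K → ℝ) : Set EReal :=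
  {t | ∃ κ : Kernel (Fin K → ℝ) Latent, Compatible c μ Q κ ∧ CateExists (κ w) ∧ cate (κ w) = t}

/-- The individual treatment effect `Y_1 - Y_0`. -/
def effect {K : ℕ} (z : (Fin K → ℝ) × Latent) : EReal :=
  ((z.2.1 true - z.2.1 false : ℝ) : EReal)

/-- `ATE = E(Y_1 - Y_0)`. -/
noncomputable def ate {K : ℕ} (μ : Measure (Fin K → ℝ)) (κ : Kernel (Fin K → ℝ) Latent) : EReal :=
  extMean (μ.compProd κ) effect

/-- `E(Y_1 - Y_0)` exists in `[-∞, ∞]`. -/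
def AteExists {K : ℕ} (μ : Measure (Fin K → ℝ)) (κ : Kernel (Fin K → ℝ) Latent) : Prop :=
  ExtMeanExists (μ.compProd κ) effect

/-- The values of `ATE` attained by populations compatible with the observed data. -/
def ateIdentifiedSet {K : ℕ} (c : ℝ) (μ : Measure (Fin K → ℝ))
    (Q : (Fin K → ℝ) → Measure (ℝ × Bool)) : Set EReal :=
  {t | ∃ κ : Kernel (Fin K → ℝ) Latent, Compatible c μ Q κ ∧ AteExists μ κ ∧ ate μ κ = t}

noncomputable def ateLower {K : ℕ} (c : ℝ) (μ : Measure (Fin K → ℝ))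
    (Q : (Fin K → ℝ) → Measure (ℝ × Bool)) : EReal :=
  extMean μ (fun w => cateLower c (Q w))

noncomputable def ateUpper {K : ℕ} (c : ℝ) (μ : Measure (Fin K → ℝ))
    (Q : (Fin K → ℝ) → Measure (ℝ × Bool)) : EReal :=
  extMean μ (fun w => cateUpper c (Q w))

end SensitivityBounds

open SensitivityBounds

/-! Validity. Write `p` for `P(X = x | W = w)` and `ρ` for the observed law of `Y` given `X = x`. On
`{X = x}` the outcome is `Y_x`, so Bayes' rule gives `ρ` the density `P(X = x | Y_x = y) / p` with
respect to the law of `Y_x`. By `c`-dependence this density lies between `minRatio = max(1 - c/p,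
0)` and `maxRatio = min(1 + c/p, 1/p)` (`potLaw_ratio_bounds`). Applied to half-lines and their
complements, this confines the cdf of `ρ` between `lowerLevel` and `upperLevel` of the cdf of `Y_x`.
Inverting confines the quantiles of `Y_x` between `quantileLower` and `quantileUpper`, and a mean is
the integral of a quantile function.

Both bounds are instances of one statement about `Y_x - Y_{1-x}` and `quantileGap`: the case `x =
true` is the upper bound, the case `x = false` the lower one with its sign changed. Because means
may be infinite, the key inequality `lintegral_effect_add_le` is stated without subtraction, between
integrals of positive and negative parts. In that form it needs no existence of means at a given `w`
and can be integrated over `w`.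

Sharpness. The levels are two-slope piecewise linear maps, so integrating a quantile function along
them amounts to reweighting `ρ` by a two-valued density (`integral_comp_twoSlope`). The extreme
slopes may be `0` or `1/p`, which can destroy the support condition and finiteness of the mean. They
are therefore contracted towards `1` by a factor `θ < 1`. The contracted densities are bounded and
exceed `p`; each then yields a counterfactual law mutually absolutely continuous with `ρ`, hence a
population satisfying every assumption (`witness`). Mixing the upper and lower densities with
weights `t` and `1 - t`, in opposite directions for `Y_1` and `Y_0`, gives the effect `t * gapMean
true - (1 - t) * gapMean false`. As `θ` increases to `1`, monotone convergence
(`extMean_of_monotone`) carries the two extremes to the stated bounds, so each interior value is hit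
exactly for some `θ < 1` and some `t`.

For the ATE one pair `(θ, t)` serves all `w`. Densities are bounded by `1 / (1 - θ)` whatever `w`
is, which gives integrability, and a second monotone convergence over `w` passes to the limit. -/

namespace SensitivityBounds

open Filter Topology

/-! ### Extended means -/

section ExtMean

variable {α : Type*} [MeasurableSpace α] {μ : Measure α}

lemma lintegral_ofReal_ne_top {f : α → ℝ} (hf : Integrable f μ) :
    ∫⁻ a, ENNReal.ofReal (f a) ∂μ ≠ ⊤ := by
  refine ne_top_of_le_ne_top hf.2.ne (lintegral_mono fun a => ?_)
  rw [← ofReal_norm]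
  exact ENNReal.ofReal_le_ofReal (le_abs_self _)

lemma toENNReal_neg_coe (x : ℝ) : (-(x : EReal)).toENNReal = ENNReal.ofReal (-x) := by
  rw [← EReal.coe_neg, EReal.real_coe_toENNReal]

lemma extMeanExists_coe {f : α → ℝ} (hf : Integrable f μ) :
    ExtMeanExists μ (fun a => (f a : EReal)) :=
  ⟨hf.1.aemeasurable.coe_real_ereal, Or.inl (by simpa using lintegral_ofReal_ne_top hf)⟩

lemma extMean_coe {f : α → ℝ} (hf : Integrable f μ) :
    extMean μ (fun a => (f a : EReal)) = ((∫ a, f a ∂μ : ℝ) : EReal) := by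
  have h1 := lintegral_ofReal_ne_top hf
  have h2 := lintegral_ofReal_ne_top hf.neg
  simp only [Pi.neg_apply] at h2
  rw [integral_eq_lintegral_pos_part_sub_lintegral_neg_part hf]
  simp only [extMean, toENNReal_neg_coe, EReal.real_coe_toENNReal, EReal.coe_sub]
  rw [EReal.coe_ennreal_toReal h1, EReal.coe_ennreal_toReal h2]

lemma extMean_congr_ae {f g : α → EReal} (h : f =ᵐ[μ] g) : extMean μ f = extMean μ g := by
  unfold extMean
  rw [lintegral_congr_ae (h.mono fun a ha => congrArg EReal.toENNReal ha),
    lintegral_congr_ae (h.mono fun a ha => congrArg (fun y : EReal => (-y).toENNReal) ha)]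

lemma ExtMeanExists.congr_ae {f g : α → EReal} (hf : ExtMeanExists μ f) (h : f =ᵐ[μ] g) :
    ExtMeanExists μ g := by
  refine ⟨hf.1.congr h, ?_⟩
  rw [← lintegral_congr_ae (h.mono fun a ha => congrArg EReal.toENNReal ha),
    ← lintegral_congr_ae (h.mono fun a ha => congrArg (fun y : EReal => (-y).toENNReal) ha)]
  exact hf.2

lemma ExtMeanExists.neg {f : α → EReal} (hf : ExtMeanExists μ f) :
    ExtMeanExists μ (fun a => -f a) :=
  ⟨hf.1.neg, by simpa only [neg_neg] using hf.2.symm⟩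

lemma extMean_neg {f : α → EReal} (hf : ExtMeanExists μ f) :
    extMean μ (fun a => -f a) = -extMean μ f := by
  unfold extMean
  simp only [neg_neg]
  rw [EReal.neg_sub (Or.inl (EReal.coe_ennreal_ne_bot _))]
  · rw [sub_eq_add_neg, add_comm]
  · simpa using hf.2

/-- Monotone convergence for extended means. -/
lemma extMean_of_monotone {f : ℕ → α → ℝ} {g : α → EReal} (hf : ∀ n, Integrable (f n) μ)
    (hmono : ∀ᵐ a ∂μ, Monotone fun n => f n a)
    (hlim : ∀ᵐ a ∂μ, Tendsto (fun n => (f n a : EReal)) atTop (𝓝 (g a))) :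
    AEMeasurable g μ ∧ ∫⁻ a, (-g a).toENNReal ∂μ ≠ ⊤ ∧
      Tendsto (fun n => ((∫ a, f n a ∂μ : ℝ) : EReal)) atTop (𝓝 (extMean μ g)) := by
  have hle : ∀ᵐ a ∂μ, ∀ n, (f n a : EReal) ≤ g a := by
    filter_upwards [hmono, hlim] with a h1 h2 n
    exact Monotone.ge_of_tendsto (f := fun n => (f n a : EReal))
      (fun i j hij => EReal.coe_le_coe_iff.2 (h1 hij)) h2 n
  have hneg : ∫⁻ a, (-g a).toENNReal ∂μ ≠ ⊤ := by
    refine ne_top_of_le_ne_top (lintegral_ofReal_ne_top (hf 0).neg) (lintegral_mono_ae ?_)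
    filter_upwards [hle] with a ha
    rw [Pi.neg_apply, ← toENNReal_neg_coe]
    exact EReal.toENNReal_le_toENNReal (EReal.neg_le_neg_iff.2 (ha 0))
  refine ⟨aemeasurable_of_tendsto_metrizable_ae atTop
    (fun n => (hf n).1.aemeasurable.coe_real_ereal) hlim, hneg, ?_⟩
  have hpos : Tendsto (fun n => ∫⁻ a, ((f n a : EReal)).toENNReal ∂μ) atTop
      (𝓝 (∫⁻ a, (g a).toENNReal ∂μ)) := by
    refine lintegral_tendsto_of_tendsto_of_monotone
      (fun n => (hf n).1.aemeasurable.coe_real_ereal.ereal_toENNReal) ?_ ?_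
    · filter_upwards [hmono] with a ha i j hij
      exact EReal.toENNReal_le_toENNReal (EReal.coe_le_coe_iff.2 (ha hij))
    · filter_upwards [hlim] with a ha
      exact (EReal.continuous_toENNReal.tendsto _).comp ha
  have hnegt : Tendsto (fun n => ∫⁻ a, (-(f n a : EReal)).toENNReal ∂μ) atTop
      (𝓝 (∫⁻ a, (-g a).toENNReal ∂μ)) := by
    refine lintegral_tendsto_of_tendsto_of_antitone
      (fun n => (hf n).1.aemeasurable.coe_real_ereal.neg.ereal_toENNReal) ?_ ?_ ?_
    · filter_upwards [hmono] with a ha i j hij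
      exact EReal.toENNReal_le_toENNReal (EReal.neg_le_neg_iff.2
        (EReal.coe_le_coe_iff.2 (ha hij)))
    · simp only [toENNReal_neg_coe]
      exact lintegral_ofReal_ne_top (hf 0).neg
    · filter_upwards [hlim] with a ha
      exact (EReal.continuous_toENNReal.tendsto _).comp (continuous_neg.tendsto _ |>.comp ha)
  have key : Tendsto (fun n => extMean μ (fun a => (f n a : EReal))) atTop (𝓝 (extMean μ g)) := by
    unfold extMean
    simp only [sub_eq_add_neg]
    have h1 := (continuous_coe_ennreal_ereal.tendsto _).comp hpos
    have h2 := (continuous_neg.tendsto _).comp ((continuous_coe_ennreal_ereal.tendsto _).comp hnegt)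
    -- Addition on `EReal` is continuous away from `∞ + (-∞)`; the finite negative part rules that
    -- out.
    refine (EReal.continuousAt_add (p := (_, _)) ?_ ?_).tendsto.comp (h1.prodMk_nhds h2)
    · right
      simpa using hneg
    · left
      exact EReal.coe_ennreal_ne_bot _
  simpa only [extMean_coe (hf _)] using key

lemma ofReal_sub_add_parts (x y : ℝ) :
    ENNReal.ofReal (x - y) + (ENNReal.ofReal (-x) + ENNReal.ofReal y) =
      ENNReal.ofReal (-(x - y)) + (ENNReal.ofReal x + ENNReal.ofReal (-y)) := by
  simp only [ENNReal.ofReal]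
  norm_cast
  rw [← NNReal.coe_inj]
  simp only [NNReal.coe_add, Real.coe_toNNReal']
  rcases max_cases (x - y) 0 with h1 | h1 <;> rcases max_cases (-x) 0 with h2 | h2 <;>
  rcases max_cases y 0 with h3 | h3 <;> rcases max_cases (-(x - y)) 0 with h4 | h4 <;>
  rcases max_cases x 0 with h5 | h5 <;> rcases max_cases (-y) 0 with h6 | h6 <;> linarith

/-- Linearity of the integral with every negative term moved to the other side, so that it stays
true when some of the integrals are infinite. -/
lemma lintegral_sub_add_parts {f g : α → ℝ} (hf : AEMeasurable f μ) (hg : AEMeasurable g μ) :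
    ∫⁻ a, ENNReal.ofReal (f a - g a) ∂μ +
        (∫⁻ a, ENNReal.ofReal (-f a) ∂μ + ∫⁻ a, ENNReal.ofReal (g a) ∂μ) =
      ∫⁻ a, ENNReal.ofReal (-(f a - g a)) ∂μ +
        (∫⁻ a, ENNReal.ofReal (f a) ∂μ + ∫⁻ a, ENNReal.ofReal (-g a) ∂μ) := by
  rw [← lintegral_add_right' _ (by fun_prop), ← lintegral_add_right' _ (by fun_prop),
    ← lintegral_add_right' _ (by fun_prop), ← lintegral_add_right' _ (by fun_prop)]
  exact lintegral_congr fun a => ofReal_sub_add_parts _ _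

lemma lintegral_ofReal_sub_le {f g : α → ℝ} (hg : AEMeasurable g μ) :
    ∫⁻ a, ENNReal.ofReal (f a - g a) ∂μ ≤
      ∫⁻ a, ENNReal.ofReal (f a) ∂μ + ∫⁻ a, ENNReal.ofReal (-g a) ∂μ := by
  rw [← lintegral_add_right' _ (by fun_prop)]
  exact lintegral_mono fun a => by rw [sub_eq_add_neg]; exact ENNReal.ofReal_add_le

end ExtMean

/-- In the application `a, b` are the integrals of the positive and negative parts of `f - g`, `c,
d` those of `f`, and `e, f` those of `g`. The finite terms are exactly those that have to be
cancelled. -/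
lemma coe_ennreal_sub_sub_of_add_eq {a b c d e f : ℝ≥0∞} (h : a + (d + e) = b + (c + f))
    (hb : b ≠ ⊤) (hd : d ≠ ⊤) (he : e ≠ ⊤) : (c - d : EReal) - (e - f) = a - b := by
  lift b to NNReal using hb
  lift d to NNReal using hd
  lift e to NNReal using he
  simp only [EReal.coe_nnreal_eq_coe_real]
  induction c with
  | top =>
    have ha : a = ⊤ := by simpa using h
    subst ha
    induction f with
    | top => simp
    | coe f =>
      simp only [EReal.coe_nnreal_eq_coe_real, EReal.coe_ennreal_top, EReal.top_sub_coe]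
      rw [← EReal.coe_sub, EReal.top_sub_coe]
  | coe c =>
    induction f with
    | top =>
      have ha : a = ⊤ := by simpa using h
      subst ha
      simp only [EReal.coe_nnreal_eq_coe_real, EReal.coe_ennreal_top, EReal.top_sub_coe,
        EReal.sub_top]
      rw [← EReal.coe_sub, EReal.coe_sub_bot]
    | coe f =>
      have ha : a ≠ ⊤ := by
        rintro rfl
        norm_cast at h
      lift a to NNReal using ha
      norm_cast at h
      have h' := congrArg NNReal.toReal h
      push_cast at h'
      simp only [EReal.coe_nnreal_eq_coe_real, ← EReal.coe_sub, EReal.coe_eq_coe_iff]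
      linarith

lemma neg_coe_ennreal_sub {x y : ℝ≥0∞} (hy : y ≠ ⊤) : -(x - y : EReal) = y - x := by
  rw [EReal.neg_sub (Or.inl (EReal.coe_ennreal_ne_bot _)) (Or.inr (by simpa using hy)),
    add_comm, ← sub_eq_add_neg]

/-- The mirror case, reduced to the previous one by negating both sides. -/
lemma coe_ennreal_sub_sub_of_add_eq' {a b c d e f : ℝ≥0∞} (h : a + (d + e) = b + (c + f))
    (ha : a ≠ ⊤) (hc : c ≠ ⊤) (hf : f ≠ ⊤) : (c - d : EReal) - (e - f) = a - b := by
  have key := coe_ennreal_sub_sub_of_add_eq h.symm ha hc hf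
  have hbot : ∀ {x y : ℝ≥0∞}, y ≠ ⊤ → (x - y : EReal) ≠ ⊥ := fun {x y} hy => by
    rw [sub_eq_add_neg, EReal.add_ne_bot_iff]
    simpa using hy
  have htop : (f - e : EReal) ≠ ⊤ := by
    rw [← neg_coe_ennreal_sub hf, Ne, EReal.neg_eq_top_iff]
    exact hbot hf
  rw [← neg_coe_ennreal_sub ha, ← neg_coe_ennreal_sub hc, ← key, EReal.neg_sub (Or.inl (hbot hc)) (Or.inr htop),
    sub_eq_add_neg, neg_coe_ennreal_sub hf]

/-- The common part of `u` and `v` cancels. This turns an inequality in the two integrals that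
define a conditional bound into one in the positive and negative parts of the bound itself, ready
for integration over the covariate. -/
lemma add_toENNReal_neg_sub_le {a b u v : ℝ≥0∞} (h : a + v ≤ b + u) (hv : v ≠ ⊤) :
    a + (-(u - v : EReal)).toENNReal ≤ b + (u - v : EReal).toENNReal := by
  rw [neg_coe_ennreal_sub hv, EReal.toENNReal_sub (EReal.coe_ennreal_nonneg _),
    EReal.toENNReal_sub (EReal.coe_ennreal_nonneg _), EReal.toENNReal_coe, EReal.toENNReal_coe]
  rcases le_total u v with huv | huv
  · rw [tsub_eq_zero_of_le huv, add_zero, ← ENNReal.addLECancellable_iff_ne.2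
      (ne_top_of_le_ne_top hv huv) |>.add_tsub_assoc_of_le huv]
    exact tsub_le_iff_right.2 h
  · rw [tsub_eq_zero_of_le huv, add_zero, ← (ENNReal.addLECancellable_iff_ne.2 hv)
      |>.add_tsub_assoc_of_le huv]
    exact ENNReal.le_sub_of_add_le_right hv h

lemma coe_ennreal_sub_le_sub {a b u v : ℝ≥0∞} (h : a + v ≤ b + u) (hab : a ≠ ⊤ ∨ b ≠ ⊤)
    (hv : v ≠ ⊤) : (a - b : EReal) ≤ u - v := by
  lift v to NNReal using hv
  induction u with
  | top => simp [EReal.coe_nnreal_eq_coe_real]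
  | coe u =>
    induction b with
    | top => simp
    | coe b =>
      have ha : a ≠ ⊤ := by rintro rfl; simp at h
      lift a to NNReal using ha
      norm_cast at h
      have h' := NNReal.coe_le_coe.2 h
      push_cast at h'
      simp only [EReal.coe_nnreal_eq_coe_real, ← EReal.coe_sub, EReal.coe_le_coe_iff]
      linarith

section ExtMean

variable {α : Type*} [MeasurableSpace α] {μ : Measure α}

/-- The mean of a difference is the difference of the means when the latter is well defined. -/
lemma extMean_coe_sub {f g : α → ℝ}
    (hf : ExtMeanExists μ fun a => (f a : EReal)) (hg : ExtMeanExists μ fun a => (g a : EReal))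
    (htop : ¬ (extMean μ (fun a => (f a : EReal)) = ⊤ ∧ extMean μ (fun a => (g a : EReal)) = ⊤))
    (hbot : ¬ (extMean μ (fun a => (f a : EReal)) = ⊥ ∧ extMean μ (fun a => (g a : EReal)) = ⊥)) :
    ExtMeanExists μ (fun a => ((f a - g a : ℝ) : EReal)) ∧
      extMean μ (fun a => (f a : EReal)) - extMean μ (fun a => (g a : EReal)) =
        extMean μ (fun a => ((f a - g a : ℝ) : EReal)) := by
  have mf : AEMeasurable f μ := by simpa using hf.1.ereal_toReal
  have mg : AEMeasurable g μ := by simpa using hg.1.ereal_toReal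
  have key := lintegral_sub_add_parts mf mg
  have ha := lintegral_ofReal_sub_le (f := f) mg
  have hb := lintegral_ofReal_sub_le (f := g) mf
  rw [add_comm] at hb
  simp only [← neg_sub (f _) (g _)] at hb
  unfold extMean ExtMeanExists at *
  simp only [toENNReal_neg_coe, EReal.real_coe_toENNReal] at *
  set A := ∫⁻ a, ENNReal.ofReal (f a - g a) ∂μ
  set B := ∫⁻ a, ENNReal.ofReal (-(f a - g a)) ∂μ
  set C := ∫⁻ a, ENNReal.ofReal (f a) ∂μ
  set D := ∫⁻ a, ENNReal.ofReal (-f a) ∂μ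
  set E := ∫⁻ a, ENNReal.ofReal (g a) ∂μ
  set F := ∫⁻ a, ENNReal.ofReal (-g a) ∂μ
  have hm : AEMeasurable (fun a => ((f a - g a : ℝ) : EReal)) μ := (mf.sub mg).coe_real_ereal
  -- Otherwise one of `D, E` and one of `C, F` are infinite. Existence of each mean excludes `C = D
  -- = ∞` and `E = F = ∞`, which leaves `D = F = ∞` (both means `⊥`) or `C = E = ∞` (both means
  -- `⊤`).
  have hcases : (D ≠ ⊤ ∧ E ≠ ⊤) ∨ (C ≠ ⊤ ∧ F ≠ ⊤) := by
    by_contra! hcon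
    obtain ⟨h1, h2⟩ := hcon
    by_cases hD : D = ⊤
    · have hC : C ≠ ⊤ := by simpa [hD] using hf.2
      have hF := h2 hC
      exact hbot ⟨by simp [hD], by simp [hF]⟩
    · have hE := h1 hD
      have hF : F ≠ ⊤ := by simpa [hE] using hg.2
      have hC : C = ⊤ := by
        by_contra hC
        exact hF (h2 hC)
      have htop_sub : ∀ {z : ℝ≥0∞}, z ≠ ⊤ → (⊤ : EReal) - z = ⊤ := fun {z} hz => by
        lift z to NNReal using hz
        rw [EReal.coe_nnreal_eq_coe_real, EReal.top_sub_coe]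
      exact htop ⟨by rw [hC]; exact htop_sub hD, by rw [hE]; exact htop_sub hF⟩
  rcases hcases with ⟨hD, hE⟩ | ⟨hC, hF⟩
  · have hB : B ≠ ⊤ := ne_top_of_le_ne_top (ENNReal.add_ne_top.2 ⟨hD, hE⟩) hb
    exact ⟨⟨hm, Or.inr hB⟩, coe_ennreal_sub_sub_of_add_eq key hB hD hE⟩
  · have hA : A ≠ ⊤ := ne_top_of_le_ne_top (ENNReal.add_ne_top.2 ⟨hC, hF⟩) ha
    refine ⟨⟨hm, Or.inl hA⟩, ?_⟩
    exact coe_ennreal_sub_sub_of_add_eq' key hA hC hF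

end ExtMean

/-! ### Quantile functions -/

section Quantile

variable {ρ : Measure ℝ}

lemma quantile_mono (ρ : Measure ℝ) : Monotone (quantile ρ) := fun _ _ huv =>
  sInf_le_sInf (image_mono fun _ hy => ⟨hy.1, huv.trans hy.2⟩)

lemma quantile_le {u y : ℝ} (hy : y ∈ ρ.support) (hu : u ≤ cdf ρ y) : quantile ρ u ≤ y :=
  sInf_le ⟨y, ⟨hy, hu⟩, rfl⟩

lemma measureReal_Ioc_eq_cdf_sub [IsProbabilityMeasure ρ] {y z : ℝ} (hyz : y ≤ z) :
    ρ.real (Ioc y z) = cdf ρ z - cdf ρ y := by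
  rw [cdf_eq_real, cdf_eq_real, ← Iic_sdiff_Iic, measureReal_sdiff (Iic_subset_Iic.2 hyz)
    measurableSet_Iic]

lemma mem_support_of_cdf_lt [IsProbabilityMeasure ρ] {y : ℝ}
    (h : ∀ z < y, cdf ρ z < cdf ρ y) : y ∈ ρ.support := by
  rw [Measure.mem_support_iff_forall]
  intro U hU
  obtain ⟨ε, hε, hball⟩ := Metric.mem_nhds_iff.1 hU
  have hsub : Ioc (y - ε / 2) y ⊆ U := by
    refine Subset.trans (fun t ht => ?_) hball
    rw [Metric.mem_ball, Real.dist_eq, abs_lt]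
    constructor <;> linarith [ht.1, ht.2]
  have hpos : 0 < ρ.real (Ioc (y - ε / 2) y) := by
    rw [measureReal_Ioc_eq_cdf_sub (by linarith), sub_pos]
    exact h _ (by linarith)
  exact (ENNReal.toReal_pos_iff.1 hpos).1.trans_le (measure_mono hsub)

/-- The infimum of `{z | u ≤ cdf ρ z}` is attained by right continuity, and it lies in the support
because the cdf is strictly smaller to its left. Inside `(0, 1)` the restriction to the support in
`quantile` therefore changes nothing, and the usual Galois connection with the cdf holds. -/
lemma exists_quantile_eq_coe [IsProbabilityMeasure ρ] {u : ℝ} (hu : u ∈ Ioo (0 : ℝ) 1) :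
    ∃ y : ℝ, quantile ρ u = y ∧ y ∈ ρ.support ∧ ∀ z, y ≤ z ↔ u ≤ cdf ρ z := by
  set S : Set ℝ := {z | u ≤ cdf ρ z} with hS
  have hne : S.Nonempty :=
    ((tendsto_cdf_atTop ρ).eventually (eventually_ge_nhds hu.2)).exists
  obtain ⟨l, hl⟩ := ((tendsto_cdf_atBot ρ).eventually (eventually_lt_nhds hu.1)).exists
  have hbdd : BddBelow S := ⟨l, fun z hz => by
    by_contra hlt
    exact absurd (hz.trans (monotone_cdf ρ (not_le.1 hlt).le)) (not_le.2 hl)⟩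
  have hmem : u ≤ cdf ρ (sInf S) := by
    have hc : ContinuousWithinAt (cdf ρ) (Ioi (sInf S)) (sInf S) :=
      ((cdf ρ).right_continuous _).mono Ioi_subset_Ici_self
    refine ge_of_tendsto hc (eventually_mem_nhdsWithin.mono fun z hz => ?_)
    obtain ⟨t, ht, htz⟩ := exists_lt_of_csInf_lt hne hz
    exact le_trans ht (monotone_cdf ρ htz.le)
  have hiff : ∀ z, sInf S ≤ z ↔ u ≤ cdf ρ z :=
    fun z => ⟨fun h => hmem.trans (monotone_cdf ρ h), fun h => csInf_le hbdd h⟩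
  have hsupp : sInf S ∈ ρ.support := mem_support_of_cdf_lt fun z hz => by
    refine lt_of_lt_of_le ?_ hmem
    by_contra hcon
    exact absurd ((hiff z).2 (not_lt.1 hcon)) (not_le.2 hz)
  refine ⟨sInf S, le_antisymm (quantile_le hsupp hmem) (le_sInf ?_), hsupp, hiff⟩
  rintro _ ⟨z, hz, rfl⟩
  exact EReal.coe_le_coe_iff.2 ((hiff z).2 hz.2)

/-- The quantile function on `(0, 1)`, where it is real valued. -/
noncomputable def realQuantile (ρ : Measure ℝ) (u : ℝ) : ℝ := (quantile ρ u).toReal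

variable [IsProbabilityMeasure ρ] {u : ℝ}

lemma coe_realQuantile (hu : u ∈ Ioo (0 : ℝ) 1) : (realQuantile ρ u : EReal) = quantile ρ u := by
  obtain ⟨y, hy, -⟩ := exists_quantile_eq_coe (ρ := ρ) hu
  rw [realQuantile, hy, EReal.toReal_coe]

lemma realQuantile_mem_support (hu : u ∈ Ioo (0 : ℝ) 1) : realQuantile ρ u ∈ ρ.support := by
  obtain ⟨y, hy, h, -⟩ := exists_quantile_eq_coe (ρ := ρ) hu
  rwa [realQuantile, hy, EReal.toReal_coe]

lemma realQuantile_le_iff (hu : u ∈ Ioo (0 : ℝ) 1) {z : ℝ} :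
    realQuantile ρ u ≤ z ↔ u ≤ cdf ρ z := by
  obtain ⟨y, hy, -, h⟩ := exists_quantile_eq_coe (ρ := ρ) hu
  rw [realQuantile, hy, EReal.toReal_coe, h]

lemma monotoneOn_realQuantile : MonotoneOn (realQuantile ρ) (Ioo 0 1) := fun u hu v hv huv => by
  rw [← EReal.coe_le_coe_iff, coe_realQuantile hu, coe_realQuantile hv]
  exact quantile_mono ρ huv

lemma le_cdf_realQuantile (hu : u ∈ Ioo (0 : ℝ) 1) : u ≤ cdf ρ (realQuantile ρ u) :=
  (realQuantile_le_iff hu).1 le_rfl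

lemma cdf_realQuantile (hρ : Continuous (cdf ρ)) (hu : u ∈ Ioo (0 : ℝ) 1) :
    cdf ρ (realQuantile ρ u) = u := by
  refine le_antisymm ?_ (le_cdf_realQuantile hu)
  have hc : ContinuousWithinAt (cdf ρ) (Iio (realQuantile ρ u)) (realQuantile ρ u) :=
    hρ.continuousWithinAt
  refine le_of_tendsto hc (eventually_mem_nhdsWithin.mono fun z hz => ?_)
  by_contra hcon
  exact absurd ((realQuantile_le_iff hu).2 (not_le.1 hcon).le) (not_le.2 hz)

lemma aemeasurable_realQuantile :
    AEMeasurable (realQuantile ρ) (volume.restrict (Ioo (0 : ℝ) 1)) :=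
  aemeasurable_restrict_of_monotoneOn measurableSet_Ioo monotoneOn_realQuantile

instance : IsProbabilityMeasure (volume.restrict (Ioo (0 : ℝ) 1)) := ⟨by simp⟩

/-- The quantile transform: `Q(U)` has law `ρ` for a uniform variable `U`. -/
lemma map_realQuantile : (volume.restrict (Ioo (0 : ℝ) 1)).map (realQuantile ρ) = ρ := by
  have := Measure.isProbabilityMeasure_map (aemeasurable_realQuantile (ρ := ρ))
  refine Measure.ext_of_Iic _ _ fun z => ?_
  rw [Measure.map_apply_of_aemeasurable aemeasurable_realQuantile measurableSet_Iic,
    ← ofReal_cdf ρ z]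
  have hset : (realQuantile ρ ⁻¹' Iic z) ∩ Ioo 0 1 = Iic (cdf ρ z) ∩ Ioo 0 1 := by
    ext u
    simp only [mem_inter_iff, mem_preimage, mem_Iic]
    exact and_congr_left fun hu => realQuantile_le_iff hu
  rw [Measure.restrict_apply' measurableSet_Ioo, hset]
  refine le_antisymm ?_ ?_
  · refine (measure_mono (t := Ioc 0 (cdf ρ z)) fun u hu => ⟨hu.2.1, hu.1⟩).trans ?_
    simp
  · refine le_trans ?_ (measure_mono (s := Ioo 0 (cdf ρ z)) fun u hu =>
      ⟨hu.2.le, hu.1, hu.2.trans_le (cdf_le_one ρ z)⟩)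
    simp

/-- Left continuity, for any law: a finite limit of quantiles stays in the closed support and its
cdf value dominates every `s n`. The level `v = 1`, with a possibly infinite quantile, is included.
-/
lemma tendsto_realQuantile_of_monotone {v : ℝ} {s : ℕ → ℝ} (hs : ∀ n, s n ∈ Ioo (0 : ℝ) 1)
    (hmono : Monotone s) (hlim : Tendsto s atTop (𝓝 v)) :
    Tendsto (fun n => (realQuantile ρ (s n) : EReal)) atTop (𝓝 (quantile ρ v)) := by
  have hm : Monotone fun n => (realQuantile ρ (s n) : EReal) := fun i j hij =>
    EReal.coe_le_coe_iff.2 (monotoneOn_realQuantile (hs i) (hs j) (hmono hij))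
  have hsup : ⨆ n, (realQuantile ρ (s n) : EReal) = quantile ρ v := by
    refine le_antisymm (iSup_le fun n => ?_) ?_
    · rw [coe_realQuantile (hs n)]
      exact quantile_mono ρ (hmono.ge_of_tendsto hlim n)
    · have ht := tendsto_atTop_iSup hm
      have hle := fun n => le_iSup (fun n => (realQuantile ρ (s n) : EReal)) n
      generalize ⨆ n, (realQuantile ρ (s n) : EReal) = L at ht hle
      induction L with
      | bot => exact absurd (hle 0) (by simp)
      | top => exact le_top
      | coe y =>
        rw [EReal.tendsto_coe] at ht
        refine quantile_le (Measure.isClosed_support.mem_of_tendsto ht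
          (Eventually.of_forall fun n => realQuantile_mem_support (hs n))) ?_
        exact le_of_tendsto' hlim fun n =>
          (realQuantile_le_iff (hs n)).1 (EReal.coe_le_coe_iff.1 (hle n))
  exact hsup ▸ tendsto_atTop_iSup hm

/-- Right continuity fails across a flat piece of the cdf, hence the assumptions on the support. The
level `v = 0` is included; there the limit is the infimum of the support, possibly `-∞`. -/
lemma tendsto_realQuantile_of_antitone (hstrict : StrictMonoOn (cdf ρ) ρ.support)
    (hconn : ρ.support.OrdConnected) {v : ℝ} {s : ℕ → ℝ} (hs : ∀ n, s n ∈ Ioo (0 : ℝ) 1)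
    (hanti : Antitone s) (hlim : Tendsto s atTop (𝓝 v)) :
    Tendsto (fun n => (realQuantile ρ (s n) : EReal)) atTop (𝓝 (quantile ρ v)) := by
  have hm : Antitone fun n => (realQuantile ρ (s n) : EReal) := fun i j hij =>
    EReal.coe_le_coe_iff.2 (monotoneOn_realQuantile (hs j) (hs i) (hanti hij))
  have hinf : ⨅ n, (realQuantile ρ (s n) : EReal) = quantile ρ v := by
    refine le_antisymm (le_sInf ?_) (le_iInf fun n => ?_)
    · rintro _ ⟨y, ⟨hy, hvy⟩, rfl⟩
      by_contra! hlt
      -- A point `z` strictly between `y` and all the quantiles lies in the interval support and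
      -- satisfies `cdf ρ z ≤ v ≤ cdf ρ y`, against strict monotonicity.
      obtain ⟨z, hyz, hz⟩ := EReal.lt_iff_exists_real_btwn.1 hlt
      rw [EReal.coe_lt_coe_iff] at hyz
      have hzn : ∀ n, z < realQuantile ρ (s n) := fun n =>
        EReal.coe_lt_coe_iff.1 (hz.trans_le (iInf_le _ n))
      have hzv : cdf ρ z ≤ v := ge_of_tendsto' hlim fun n => by
        by_contra! h
        exact absurd ((realQuantile_le_iff (hs n)).2 h.le) (not_le.2 (hzn n))
      have hzs : z ∈ ρ.support :=
        hconn.out hy (realQuantile_mem_support (hs 0)) ⟨hyz.le, (hzn 0).le⟩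
      exact absurd (hstrict hy hzs hyz) (not_lt.2 (hzv.trans hvy))
    · rw [coe_realQuantile (hs n)]
      exact quantile_mono ρ (hanti.le_of_tendsto hlim n)
  exact hinf ▸ tendsto_atTop_iInf hm

end Quantile

/-! ### Piecewise linear distortions of the unit interval -/

section TwoSlope

/-- The abscissa at which the lines `τ ↦ s * τ` and `τ ↦ 1 - t * (1 - τ)` meet. -/
noncomputable def kink (s t : ℝ) : ℝ := (1 - t) / (s - t)

/-- The piecewise linear bijection of `[0, 1]` with slope `s` and then slope `t`. -/
noncomputable def twoSlope (s t τ : ℝ) : ℝ :=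
  if τ ≤ kink s t then s * τ else 1 - t * (1 - τ)

/-- The density of the image of Lebesgue measure on `[0, 1]` under `twoSlope s t`. -/
noncomputable def slopeDensity (s t u : ℝ) : ℝ := if u ≤ s * kink s t then s⁻¹ else t⁻¹

variable {s t : ℝ}

lemma kink_spec (hst : t ≤ 1 ∧ 1 ≤ s ∨ s ≤ 1 ∧ 1 ≤ t) :
    kink s t ∈ Icc (0 : ℝ) 1 ∧ s * kink s t = 1 - t * (1 - kink s t) := by
  by_cases h : s - t = 0
  -- Here `s = t = 1`, the two lines coincide, and `kink` is `0 / 0 = 0`.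
  · have : t = 1 := by rcases hst with h' | h' <;> linarith
    simp [kink, this]
  · refine ⟨?_, ?_⟩
    · rw [kink, mem_Icc]
      rcases hst with h' | h'
      · have hpos : 0 < s - t := lt_of_le_of_ne (by linarith) (Ne.symm h)
        exact ⟨div_nonneg (by linarith) hpos.le, (div_le_one hpos).2 (by linarith)⟩
      · have hneg : s - t < 0 := lt_of_le_of_ne (by linarith) h
        exact ⟨div_nonneg_of_nonpos (by linarith) hneg.le,
          (div_le_one_of_neg hneg).2 (by linarith)⟩
    · have : kink s t * (s - t) = 1 - t := by rw [kink]; field_simp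
      linarith

lemma twoSlope_eq_min (ht : t ≤ 1) (hs : 1 ≤ s) (τ : ℝ) :
    twoSlope s t τ = min (s * τ) (1 - t * (1 - τ)) := by
  have hk := (kink_spec (Or.inl ⟨ht, hs⟩)).2
  rw [twoSlope]
  split_ifs with h
  · rw [min_eq_left]
    nlinarith
  · rw [min_eq_right]
    nlinarith

lemma twoSlope_eq_max (hs : s ≤ 1) (ht : 1 ≤ t) (τ : ℝ) :
    twoSlope s t τ = max (s * τ) (1 - t * (1 - τ)) := by
  have hk := (kink_spec (Or.inr ⟨hs, ht⟩)).2
  rw [twoSlope]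
  split_ifs with h
  · rw [max_eq_left]
    nlinarith
  · rw [max_eq_right]
    nlinarith

/-- An affine change of variables on each side of the kink. With `f` a quantile function, the left
side is the mean of a distorted quantile function and the right side the mean of a reweighted law.
-/
lemma integral_comp_twoSlope (hs0 : 0 < s) (ht0 : 0 < t)
    (hst : t ≤ 1 ∧ 1 ≤ s ∨ s ≤ 1 ∧ 1 ≤ t) {f : ℝ → ℝ} (hf : IntegrableOn f (Ioo 0 1)) :
    IntegrableOn (fun τ => f (twoSlope s t τ)) (Ioo 0 1) ∧
      ∫ τ in Ioo 0 1, f (twoSlope s t τ) = ∫ u in Ioo 0 1, f u * slopeDensity s t u := by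
  obtain ⟨⟨hk0, hk1⟩, hk⟩ := kink_spec hst
  set T := kink s t with hT
  have hsT0 : 0 ≤ s * T := by positivity
  have hsT1 : s * T ≤ 1 := by nlinarith
  have hi : IntervalIntegrable f volume 0 1 := by
    rwa [intervalIntegrable_iff_integrableOn_Ioo_of_le zero_le_one]
  have hi1 : IntervalIntegrable f volume 0 (s * T) :=
    hi.mono_set (by rw [uIcc_of_le hsT0, uIcc_of_le zero_le_one]; exact Icc_subset_Icc_right hsT1)
  have hi2 : IntervalIntegrable f volume (s * T) 1 :=
    hi.mono_set (by rw [uIcc_of_le hsT1, uIcc_of_le zero_le_one]; exact Icc_subset_Icc_left hsT0)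
  have hg1 : EqOn (fun τ => f (s * τ)) (fun τ => f (twoSlope s t τ)) (Ioc 0 T) := fun τ hτ => by
    simp only [twoSlope, ← hT, if_pos hτ.2]
  have hg2 : EqOn (fun τ => f (t * τ + (1 - t))) (fun τ => f (twoSlope s t τ)) (Ioc T 1) :=
    fun τ hτ => by
      simp only [twoSlope, ← hT, if_neg (not_le.2 hτ.1)]
      congr 1; ring
  have hd1 : EqOn (fun u => f u * s⁻¹) (fun u => f u * slopeDensity s t u) (Ioc 0 (s * T)) :=
    fun u hu => by simp only [slopeDensity, ← hT, if_pos hu.2]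
  have hd2 : EqOn (fun u => f u * t⁻¹) (fun u => f u * slopeDensity s t u) (Ioc (s * T) 1) :=
    fun u hu => by simp only [slopeDensity, ← hT, if_neg (not_le.2 hu.1)]
  have hj1 : IntervalIntegrable (fun τ => f (twoSlope s t τ)) volume 0 T := by
    have := hi1.comp_mul_left (c := s)
    rw [zero_div, mul_div_cancel_left₀ _ hs0.ne'] at this
    exact this.congr (by rw [uIoc_of_le hk0]; exact hg1)
  have hj2 : IntervalIntegrable (fun τ => f (twoSlope s t τ)) volume T 1 := by
    have := (hi2.comp_add_right (1 - t)).comp_mul_left (c := t)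
    rw [show (s * T - (1 - t)) / t = T by rw [hk]; field_simp; ring,
      show (1 - (1 - t)) / t = 1 by field_simp; ring] at this
    exact this.congr (by rw [uIoc_of_le hk1]; exact hg2)
  refine ⟨(intervalIntegrable_iff_integrableOn_Ioo_of_le zero_le_one).1 (hj1.trans hj2), ?_⟩
  rw [← integral_Ioc_eq_integral_Ioo, ← integral_Ioc_eq_integral_Ioo,
    ← intervalIntegral.integral_of_le zero_le_one, ← intervalIntegral.integral_of_le zero_le_one,
    ← intervalIntegral.integral_add_adjacent_intervals hj1 hj2,
    ← intervalIntegral.integral_add_adjacent_intervals (b := s * T)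
      ((hi1.mul_const s⁻¹).congr (by rw [uIoc_of_le hsT0]; exact hd1))
      ((hi2.mul_const t⁻¹).congr (by rw [uIoc_of_le hsT1]; exact hd2)),
    intervalIntegral.integral_of_le hk0, intervalIntegral.integral_of_le hk1,
    intervalIntegral.integral_of_le hsT0, intervalIntegral.integral_of_le hsT1,
    ← setIntegral_congr_fun measurableSet_Ioc hg1, ← setIntegral_congr_fun measurableSet_Ioc hg2,
    ← setIntegral_congr_fun measurableSet_Ioc hd1, ← setIntegral_congr_fun measurableSet_Ioc hd2,
    ← intervalIntegral.integral_of_le hk0, ← intervalIntegral.integral_of_le hk1,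
    ← intervalIntegral.integral_of_le hsT0, ← intervalIntegral.integral_of_le hsT1,
    intervalIntegral.integral_comp_mul_left _ hs0.ne',
    intervalIntegral.integral_comp_mul_add _ ht0.ne',
    intervalIntegral.integral_mul_const, intervalIntegral.integral_mul_const]
  rw [show t * T + (1 - t) = s * T by rw [hk]; ring]
  simp [mul_comm]

lemma slopeDensity_mem {lo hi : ℝ} (hlo : 0 < lo) (hs : s ∈ Icc lo hi) (ht : t ∈ Icc lo hi)
    (u : ℝ) : slopeDensity s t u ∈ Icc hi⁻¹ lo⁻¹ := by
  have key : ∀ r ∈ Icc lo hi, r⁻¹ ∈ Icc hi⁻¹ lo⁻¹ := fun r hr =>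
    ⟨inv_anti₀ (hlo.trans_le hr.1) hr.2, inv_anti₀ hlo hr.1⟩
  rw [slopeDensity]
  split_ifs
  exacts [key _ hs, key _ ht]

end TwoSlope

/-! ### The quantile levels of the bounds -/

section Levels

noncomputable def upperLevel (c p τ : ℝ) : ℝ := min (min (τ + c / p * min τ (1 - τ)) (τ / p)) 1

noncomputable def lowerLevel (c p τ : ℝ) : ℝ :=
  max (max (τ - c / p * min τ (1 - τ)) ((τ - 1) / p + 1)) 0

/-- The largest value of `P(X = x | Y_x = y) / p` allowed by `c`-dependence. -/
noncomputable def maxRatio (c p : ℝ) : ℝ := min (1 + c / p) (1 / p)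

/-- The smallest value of `P(X = x | Y_x = y) / p` allowed by `c`-dependence. -/
noncomputable def minRatio (c p : ℝ) : ℝ := max (1 - c / p) 0

variable {c p : ℝ}

lemma one_le_maxRatio (hc : 0 ≤ c) (hp : p ∈ Ioo (0 : ℝ) 1) : 1 ≤ maxRatio c p :=
  le_min (by have := div_nonneg hc hp.1.le; linarith) ((one_le_div hp.1).2 hp.2.le)

lemma minRatio_le_one (hc : 0 ≤ c) (hp : p ∈ Ioo (0 : ℝ) 1) : minRatio c p ≤ 1 :=
  max_le (by have := div_nonneg hc hp.1.le; linarith) zero_le_one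

lemma minRatio_nonneg : 0 ≤ minRatio c p := le_max_right _ _

/-- Distributing the inner minimum leaves four lines: two through `(0, 0)` with slopes `1 + c/p` and
`1/p`, and two through `(1, 1)` with slopes `1 - c/p` and `0`. On `[0, 1]` each pair collapses to
its lower line. -/
lemma upperLevel_eq (hc : 0 ≤ c) (hp : p ∈ Ioo (0 : ℝ) 1) {τ : ℝ} (hτ : τ ∈ Icc (0 : ℝ) 1) :
    upperLevel c p τ = min (maxRatio c p * τ) (1 - minRatio c p * (1 - τ)) := by
  have hcp : 0 ≤ c / p := div_nonneg hc hp.1.le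
  rw [upperLevel, maxRatio, minRatio, min_mul_of_nonneg _ _ hτ.1,
    max_mul_of_nonneg _ _ (sub_nonneg.2 hτ.2), zero_mul, mul_min_of_nonneg _ _ hcp,
    ← min_add_add_left, sub_eq_add_neg 1 (max _ _), ← min_neg_neg, ← min_add_add_left,
    show (1 + c / p) * τ = τ + c / p * τ by ring,
    show 1 + -((1 - c / p) * (1 - τ)) = τ + c / p * (1 - τ) by ring, one_div_mul_eq_div,
    neg_zero, add_zero]
  ac_rfl

lemma lowerLevel_eq_one_sub (τ : ℝ) : lowerLevel c p τ = 1 - upperLevel c p (1 - τ) := by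
  have h1 : τ - c / p * min τ (1 - τ) = 1 - (1 - τ + c / p * min τ (1 - τ)) := by ring
  have h2 : (τ - 1) / p + 1 = 1 - (1 - τ) / p := by ring
  rw [lowerLevel, upperLevel, sub_sub_cancel, min_comm (1 - τ), h1, h2]
  nth_rewrite 1 [show (0 : ℝ) = 1 - 1 by ring]
  rw [max_sub_sub_left, max_sub_sub_left]

lemma lowerLevel_eq (hc : 0 ≤ c) (hp : p ∈ Ioo (0 : ℝ) 1) {τ : ℝ} (hτ : τ ∈ Icc (0 : ℝ) 1) :
    lowerLevel c p τ = max (minRatio c p * τ) (1 - maxRatio c p * (1 - τ)) := by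
  rw [lowerLevel_eq_one_sub, upperLevel_eq hc hp ⟨by linarith [hτ.2], by linarith [hτ.1]⟩,
    sub_eq_add_neg 1 (min _ _), ← max_neg_neg, ← max_add_add_left, max_comm]
  congr 1; ring

lemma upperLevel_mem (hc : 0 ≤ c) (hp : p ∈ Ioo (0 : ℝ) 1) {τ : ℝ} (hτ : τ ∈ Icc (0 : ℝ) 1) :
    upperLevel c p τ ∈ Icc τ 1 := by
  refine ⟨le_min (le_min ?_ ?_) hτ.2, min_le_right _ _⟩
  · have : 0 ≤ c / p * min τ (1 - τ) :=
      mul_nonneg (div_nonneg hc hp.1.le) (le_min hτ.1 (by linarith [hτ.2]))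
    linarith
  · rw [le_div_iff₀ hp.1]
    nlinarith [hτ.1, hp.2]

lemma lowerLevel_mem (hc : 0 ≤ c) (hp : p ∈ Ioo (0 : ℝ) 1) {τ : ℝ} (hτ : τ ∈ Icc (0 : ℝ) 1) :
    lowerLevel c p τ ∈ Icc 0 τ := by
  have := upperLevel_mem hc hp (τ := 1 - τ) ⟨by linarith [hτ.2], by linarith [hτ.1]⟩
  rw [lowerLevel_eq_one_sub]
  exact ⟨by linarith [this.2], by linarith [this.1]⟩

lemma lowerLevel_mono (hc : 0 ≤ c) (hp : p ∈ Ioo (0 : ℝ) 1) :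
    MonotoneOn (lowerLevel c p) (Icc 0 1) := fun σ hσ τ hτ hστ => by
  rw [lowerLevel_eq hc hp hσ, lowerLevel_eq hc hp hτ]
  have h1 := one_le_maxRatio hc hp
  have h2 := minRatio_nonneg (c := c) (p := p)
  exact max_le_max (by gcongr) (by gcongr)

/-- The upper level is strictly increasing until it reaches `1`. -/
lemma upperLevel_lt (hc : 0 ≤ c) (hp : p ∈ Ioo (0 : ℝ) 1) {σ τ : ℝ} (hσ : σ ∈ Icc (0 : ℝ) 1)
    (hτ : τ ∈ Icc (0 : ℝ) 1) (hστ : σ < τ) (hlt : upperLevel c p τ < 1) :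
    upperLevel c p σ < upperLevel c p τ := by
  have h1 := one_le_maxRatio hc hp
  have hs : maxRatio c p * σ < maxRatio c p * τ := by gcongr
  rw [upperLevel_eq hc hp hτ] at hlt
  rw [upperLevel_eq hc hp hσ, upperLevel_eq hc hp hτ]
  rcases (minRatio_nonneg (c := c) (p := p)).eq_or_lt with h0 | h0
  · rw [← h0] at hlt ⊢
    simp only [zero_mul, sub_zero, min_lt_iff, lt_irrefl, or_false] at hlt
    simp only [zero_mul, sub_zero]
    rw [min_eq_left hlt.le]
    exact (min_le_left _ _).trans_lt hs
  · exact min_lt_min hs (by gcongr)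

/-- The ratio bounds contracted towards `1`. -/
noncomputable def shrunkMaxRatio (θ c p : ℝ) : ℝ := 1 + θ * (maxRatio c p - 1)

noncomputable def shrunkMinRatio (θ c p : ℝ) : ℝ := 1 - θ * (1 - minRatio c p)

noncomputable def shrunkUpperLevel (θ c p τ : ℝ) : ℝ := τ + θ * (upperLevel c p τ - τ)

noncomputable def shrunkLowerLevel (θ c p τ : ℝ) : ℝ := τ + θ * (lowerLevel c p τ - τ)

variable {θ : ℝ}

lemma one_le_shrunkMaxRatio (hθ : 0 ≤ θ) (hc : 0 ≤ c) (hp : p ∈ Ioo (0 : ℝ) 1) :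
    1 ≤ shrunkMaxRatio θ c p :=
  le_add_of_nonneg_right (mul_nonneg hθ (sub_nonneg.2 (one_le_maxRatio hc hp)))

lemma shrunkMinRatio_le_one (hθ : 0 ≤ θ) (hc : 0 ≤ c) (hp : p ∈ Ioo (0 : ℝ) 1) :
    shrunkMinRatio θ c p ≤ 1 :=
  sub_le_self _ (mul_nonneg hθ (sub_nonneg.2 (minRatio_le_one hc hp)))

lemma one_sub_le_shrunkMinRatio (hθ : 0 ≤ θ) : 1 - θ ≤ shrunkMinRatio θ c p := by
  have := mul_nonneg hθ (minRatio_nonneg (c := c) (p := p))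
  rw [shrunkMinRatio]
  linarith

/-- Strictness is what contraction buys: it keeps `P(X = x | Y_x = y)` below `1`, so the
counterfactual density is positive everywhere. -/
lemma mul_shrunkMaxRatio_lt_one (hθ : θ ∈ Ico (0 : ℝ) 1) (hp : p ∈ Ioo (0 : ℝ) 1) :
    p * shrunkMaxRatio θ c p < 1 := by
  have h1 : maxRatio c p ≤ 1 / p := min_le_right _ _
  rw [le_div_iff₀ hp.1] at h1
  rw [shrunkMaxRatio]
  nlinarith [hθ.1, hθ.2, hp.1, hp.2, mul_nonneg hθ.1 (sub_nonneg.2 h1),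
    mul_pos (sub_pos.2 hθ.2) (sub_pos.2 hp.2)]

lemma mul_shrunkMaxRatio_le (hθ : θ ∈ Ico (0 : ℝ) 1) (hc : 0 ≤ c) (hp : p ∈ Ioo (0 : ℝ) 1) :
    p * shrunkMaxRatio θ c p ≤ p + c := by
  have h1 : maxRatio c p - 1 ≤ c / p := by
    rw [maxRatio, sub_le_iff_le_add']
    exact min_le_left _ _
  have h2 : θ * (maxRatio c p - 1) ≤ c / p :=
    (mul_le_of_le_one_left (sub_nonneg.2 (one_le_maxRatio hc hp)) hθ.2.le).trans h1
  rw [le_div_iff₀ hp.1] at h2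
  rw [shrunkMaxRatio]
  linarith

lemma le_mul_shrunkMinRatio (hθ : θ ∈ Ico (0 : ℝ) 1) (hc : 0 ≤ c) (hp : p ∈ Ioo (0 : ℝ) 1) :
    p - c ≤ p * shrunkMinRatio θ c p := by
  have h1 : 1 - minRatio c p ≤ c / p := by
    rw [minRatio, sub_le_comm]
    exact le_max_left _ _
  have h2 : θ * (1 - minRatio c p) ≤ c / p :=
    (mul_le_of_le_one_left (sub_nonneg.2 (minRatio_le_one hc hp)) hθ.2.le).trans h1
  rw [le_div_iff₀ hp.1] at h2
  rw [shrunkMinRatio]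
  linarith

/-- The identity passes through both fixed points `(0, 0)` and `(1, 1)` of the lines, so contracting
the level towards it is the same as contracting the two slopes towards `1`. -/
lemma shrunkUpperLevel_eq (hθ : 0 ≤ θ) (hc : 0 ≤ c) (hp : p ∈ Ioo (0 : ℝ) 1) {τ : ℝ}
    (hτ : τ ∈ Icc (0 : ℝ) 1) : shrunkUpperLevel θ c p τ =
      twoSlope (shrunkMaxRatio θ c p) (shrunkMinRatio θ c p) τ := by
  rw [twoSlope_eq_min (shrunkMinRatio_le_one hθ hc hp) (one_le_shrunkMaxRatio hθ hc hp),
    shrunkUpperLevel, upperLevel_eq hc hp hτ, ← min_sub_sub_right, mul_min_of_nonneg _ _ hθ,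
    ← min_add_add_left, shrunkMaxRatio, shrunkMinRatio]
  congr 1 <;> ring

lemma shrunkLowerLevel_eq (hθ : 0 ≤ θ) (hc : 0 ≤ c) (hp : p ∈ Ioo (0 : ℝ) 1) {τ : ℝ}
    (hτ : τ ∈ Icc (0 : ℝ) 1) : shrunkLowerLevel θ c p τ =
      twoSlope (shrunkMinRatio θ c p) (shrunkMaxRatio θ c p) τ := by
  rw [twoSlope_eq_max (shrunkMinRatio_le_one hθ hc hp) (one_le_shrunkMaxRatio hθ hc hp),
    shrunkLowerLevel, lowerLevel_eq hc hp hτ, ← max_sub_sub_right, mul_max_of_nonneg _ _ hθ,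
    ← max_add_add_left, shrunkMaxRatio, shrunkMinRatio]
  congr 1 <;> ring

lemma shrunkUpperLevel_mem (hθ : θ ∈ Ico (0 : ℝ) 1) (hc : 0 ≤ c) (hp : p ∈ Ioo (0 : ℝ) 1)
    {τ : ℝ} (hτ : τ ∈ Ioo (0 : ℝ) 1) : shrunkUpperLevel θ c p τ ∈ Ioo (0 : ℝ) 1 := by
  have h := upperLevel_mem hc hp (Ioo_subset_Icc_self hτ)
  rw [shrunkUpperLevel]
  have h1 := mul_nonneg hθ.1 (sub_nonneg.2 h.1)
  have h2 := mul_nonneg hθ.1 (sub_nonneg.2 h.2)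
  have h3 := mul_pos (sub_pos.2 hθ.2) (sub_pos.2 hτ.2)
  exact ⟨by linarith [hτ.1], by linarith⟩

lemma shrunkLowerLevel_mem (hθ : θ ∈ Ico (0 : ℝ) 1) (hc : 0 ≤ c) (hp : p ∈ Ioo (0 : ℝ) 1)
    {τ : ℝ} (hτ : τ ∈ Ioo (0 : ℝ) 1) : shrunkLowerLevel θ c p τ ∈ Ioo (0 : ℝ) 1 := by
  have h := lowerLevel_mem hc hp (Ioo_subset_Icc_self hτ)
  rw [shrunkLowerLevel]
  have h1 := mul_nonneg hθ.1 h.1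
  have h2 := mul_nonneg hθ.1 (sub_nonneg.2 h.2)
  have h3 := mul_pos (sub_pos.2 hθ.2) hτ.1
  exact ⟨by linarith, by linarith [hτ.2]⟩

/-- A sequence of contraction factors increasing to `1`. -/
noncomputable def contraction (n : ℕ) : ℝ := 1 - 1 / ((n : ℝ) + 1)

lemma contraction_mem (n : ℕ) : contraction n ∈ Ico (0 : ℝ) 1 := by
  have : 1 / ((n : ℝ) + 1) ≤ 1 := (div_le_one (by positivity)).2 (by linarith [n.cast_nonneg (α := ℝ)])
  exact ⟨sub_nonneg.2 this, sub_lt_self _ (by positivity)⟩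

lemma contraction_mono : Monotone contraction := fun i j hij =>
  sub_le_sub_left (one_div_le_one_div_of_le (by positivity) (by gcongr)) _

lemma tendsto_contraction : Tendsto contraction atTop (𝓝 1) := by
  unfold contraction
  simpa only [sub_zero] using (tendsto_const_nhds (x := (1 : ℝ))).sub
    (tendsto_one_div_add_atTop_nhds_zero_nat (𝕜 := ℝ))

lemma tendsto_contraction_level {τ v : ℝ} :
    Tendsto (fun n => τ + contraction n * (v - τ)) atTop (𝓝 v) := by
  simpa using (tendsto_contraction.mul_const (v - τ)).const_add τ

end Levels

/-! ### Observed laws -/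

section Observed

lemma measurable_observe : Measurable observe := by
  unfold observe
  refine Measurable.prodMk (Measurable.ite ?_ ?_ ?_) measurable_snd
  · exact measurable_snd (measurableSet_singleton true)
  · exact (measurable_pi_apply true).comp measurable_fst
  · exact (measurable_pi_apply false).comp measurable_fst

lemma measurable_potential (x : Bool) : Measurable fun ω : Latent => ω.1 x :=
  (measurable_pi_apply x).comp measurable_fst

lemma measurableSet_treatment (x : Bool) : MeasurableSet {ω : Latent | ω.2 = x} :=
  measurable_snd (measurableSet_singleton x)

lemma measurableSet_snd_eq (x : Bool) : MeasurableSet {o : ℝ × Bool | o.2 = x} :=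
  measurable_snd (measurableSet_singleton x)

variable {ν : Measure Latent}

lemma propensity_obsLaw (x : Bool) : propensity (obsLaw ν) x = ν.real {ω : Latent | ω.2 = x} := by
  rw [propensity, obsLaw, map_measureReal_apply measurable_observe (measurableSet_snd_eq x)]
  rfl

lemma outcomeLaw_apply {q : Measure (ℝ × Bool)} {x : Bool} {s : Set ℝ} (hs : MeasurableSet s) :
    outcomeLaw q x s =
      (q {o : ℝ × Bool | o.2 = x})⁻¹ * q ({o : ℝ × Bool | o.2 = x} ∩ Prod.fst ⁻¹' s) := by
  rw [outcomeLaw, Measure.map_apply measurable_fst hs, cond_apply (measurableSet_snd_eq x)]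

lemma potLawGiven_apply {x x' : Bool} {s : Set ℝ} (hs : MeasurableSet s) :
    potLawGiven ν x x' s = (ν {ω : Latent | ω.2 = x'})⁻¹ *
      ν ({ω : Latent | ω.2 = x'} ∩ (fun ω : Latent => ω.1 x) ⁻¹' s) := by
  rw [potLawGiven, Measure.map_apply (measurable_potential x) hs,
    cond_apply (measurableSet_treatment x')]

lemma outcomeLaw_obsLaw (x : Bool) : outcomeLaw (obsLaw ν) x = potLawGiven ν x x := by
  ext s hs
  rw [outcomeLaw_apply hs, potLawGiven_apply hs, obsLaw,
    Measure.map_apply measurable_observe (measurableSet_snd_eq x),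
    Measure.map_apply measurable_observe ((measurableSet_snd_eq x).inter (measurable_fst hs))]
  congr 2
  ext ⟨y, x'⟩
  simp only [observe, preimage_inter, mem_inter_iff, mem_preimage, mem_ofPred_eq]
  refine and_congr_right fun h => ?_
  subst h
  cases x' <;> simp

instance [IsProbabilityMeasure ν] : IsProbabilityMeasure (obsLaw ν) :=
  Measure.isProbabilityMeasure_map measurable_observe.aemeasurable

instance [IsProbabilityMeasure ν] (x : Bool) : IsProbabilityMeasure (potLaw ν x) :=
  Measure.isProbabilityMeasure_map (measurable_potential x).aemeasurable

lemma propensity_not {q : Measure (ℝ × Bool)} [IsProbabilityMeasure q] (x : Bool) :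
    propensity q (!x) = 1 - propensity q x := by
  rw [propensity, propensity, ← probReal_compl_eq_one_sub (measurableSet_snd_eq x)]
  congr 1
  ext o
  simp only [mem_ofPred_eq, mem_compl_iff]
  cases o.2 <;> cases x <;> simp

lemma isProbabilityMeasure_outcomeLaw {q : Measure (ℝ × Bool)} [IsProbabilityMeasure q] {x : Bool}
    (h : 0 < propensity q x) : IsProbabilityMeasure (outcomeLaw q x) := by
  have : IsProbabilityMeasure (q[|{o : ℝ × Bool | o.2 = x}]) :=
    cond_isProbabilityMeasure (ENNReal.toReal_pos_iff.1 h).1.ne'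
  exact Measure.isProbabilityMeasure_map measurable_fst.aemeasurable

/-- The regularity of the conditional law of `(Y, X)` that the maintained assumptions entail, and
integrability of the outcome. -/
structure RegularObserved (q : Measure (ℝ × Bool)) : Prop where
  isProbabilityMeasure : IsProbabilityMeasure q
  propensity_mem : ∀ x, propensity q x ∈ Ioo (0 : ℝ) 1
  continuous_cdf : ∀ x, Continuous (cdf (outcomeLaw q x))
  strictMonoOn_cdf : ∀ x, StrictMonoOn (cdf (outcomeLaw q x)) (outcomeLaw q x).support
  support_eq : ∀ x, ∃ a b : EReal, a < b ∧
    (outcomeLaw q x).support = {y : ℝ | a ≤ (y : EReal) ∧ (y : EReal) ≤ b}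
  integrable : ∀ x, Integrable (fun y : ℝ => y) (outcomeLaw q x)

lemma RegularAt.regularObserved [IsProbabilityMeasure ν] (h : RegularAt ν)
    (hmom : ∀ x, ∫⁻ y, ‖y‖ₑ ∂(outcomeLaw (obsLaw ν) x) < ⊤) : RegularObserved (obsLaw ν) where
  isProbabilityMeasure := inferInstance
  propensity_mem := by
    have htrue : propensity (obsLaw ν) true ∈ Ioo (0 : ℝ) 1 := by
      rw [propensity_obsLaw]; exact h.overlap
    intro x
    cases x
    · rw [show false = !true from rfl, propensity_not]
      exact ⟨by linarith [htrue.2], by linarith [htrue.1]⟩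
    · exact htrue
  continuous_cdf x := by rw [outcomeLaw_obsLaw]; exact h.continuous_cdf x x
  strictMonoOn_cdf x := by rw [outcomeLaw_obsLaw]; exact h.strictMonoOn_cdf x x
  support_eq x := by
    obtain ⟨a, b, hab, hs, hx⟩ := h.support_eq x
    exact ⟨a, b, hab, by rw [outcomeLaw_obsLaw, hx, hs]⟩
  integrable x := ⟨measurable_id.aestronglyMeasurable, hmom x⟩

namespace RegularObserved

variable {q : Measure (ℝ × Bool)} (hq : RegularObserved q)
include hq

lemma isProbabilityMeasure_outcomeLaw (x : Bool) : IsProbabilityMeasure (outcomeLaw q x) :=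
  have := hq.isProbabilityMeasure
  SensitivityBounds.isProbabilityMeasure_outcomeLaw (hq.propensity_mem x).1

lemma ordConnected_support (x : Bool) : (outcomeLaw q x).support.OrdConnected := by
  obtain ⟨a, b, -, h⟩ := hq.support_eq x
  rw [h]
  refine ⟨fun y hy z hz t ht => ⟨hy.1.trans ?_, le_trans ?_ hz.2⟩⟩
  · exact EReal.coe_le_coe_iff.2 ht.1
  · exact EReal.coe_le_coe_iff.2 ht.2

end RegularObserved

end Observed

/-! ### The gap between the upper bound of one quantile function and the lower bound of the other -/

section Gap

/-- One object for both bounds: at `true` it is `cqteUpper`, at `false` it is the negative of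
`cqteLower` on `(0, 1)`. -/
noncomputable def quantileGap (c : ℝ) (q : Measure (ℝ × Bool)) (x : Bool) (τ : ℝ) : EReal :=
  quantileUpper c q x τ - quantileLower c q (!x) τ

noncomputable def shrunkUpper (θ c : ℝ) (q : Measure (ℝ × Bool)) (x : Bool) (τ : ℝ) : ℝ :=
  realQuantile (outcomeLaw q x) (shrunkUpperLevel θ c (propensity q x) τ)

noncomputable def shrunkLower (θ c : ℝ) (q : Measure (ℝ × Bool)) (x : Bool) (τ : ℝ) : ℝ :=
  realQuantile (outcomeLaw q x) (shrunkLowerLevel θ c (propensity q x) τ)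

lemma integrableOn_realQuantile {ρ : Measure ℝ} [IsProbabilityMeasure ρ]
    (h : Integrable (fun y : ℝ => y) ρ) : IntegrableOn (realQuantile ρ) (Ioo 0 1) := by
  rw [← map_realQuantile (ρ := ρ)] at h
  exact (integrable_map_measure measurable_id.aestronglyMeasurable aemeasurable_realQuantile).1 h

variable {c : ℝ} {q : Measure (ℝ × Bool)}

namespace RegularObserved

variable (hq : RegularObserved q) (hc : 0 ≤ c)
include hq hc

lemma integrableOn_shrunkUpper {θ : ℝ} (hθ : θ ∈ Ico (0 : ℝ) 1) (x : Bool) :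
    IntegrableOn (shrunkUpper θ c q x) (Ioo 0 1) ∧
      ∫ τ in Ioo 0 1, shrunkUpper θ c q x τ =
        ∫ u in Ioo 0 1, realQuantile (outcomeLaw q x) u *
          slopeDensity (shrunkMaxRatio θ c (propensity q x))
            (shrunkMinRatio θ c (propensity q x)) u := by
  have := hq.isProbabilityMeasure_outcomeLaw x
  have hp := hq.propensity_mem x
  have hmin := (sub_pos.2 hθ.2).trans_le
    (one_sub_le_shrunkMinRatio (c := c) (p := propensity q x) hθ.1)
  have hmax := one_le_shrunkMaxRatio hθ.1 hc hp
  have key := integral_comp_twoSlope (zero_lt_one.trans_le hmax) hmin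
    (Or.inl ⟨shrunkMinRatio_le_one hθ.1 hc hp, hmax⟩)
    (integrableOn_realQuantile (hq.integrable x))
  have heq : EqOn (fun τ => realQuantile (outcomeLaw q x)
      (twoSlope (shrunkMaxRatio θ c (propensity q x)) (shrunkMinRatio θ c (propensity q x)) τ))
      (shrunkUpper θ c q x) (Ioo 0 1) := fun τ hτ => by
    rw [shrunkUpper, shrunkUpperLevel_eq hθ.1 hc hp (Ioo_subset_Icc_self hτ)]
  exact ⟨key.1.congr_fun heq measurableSet_Ioo,
    (setIntegral_congr_fun measurableSet_Ioo heq).symm.trans key.2⟩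

lemma integrableOn_shrunkLower {θ : ℝ} (hθ : θ ∈ Ico (0 : ℝ) 1) (x : Bool) :
    IntegrableOn (shrunkLower θ c q x) (Ioo 0 1) ∧
      ∫ τ in Ioo 0 1, shrunkLower θ c q x τ =
        ∫ u in Ioo 0 1, realQuantile (outcomeLaw q x) u *
          slopeDensity (shrunkMinRatio θ c (propensity q x))
            (shrunkMaxRatio θ c (propensity q x)) u := by
  have := hq.isProbabilityMeasure_outcomeLaw x
  have hp := hq.propensity_mem x
  have hmin := (sub_pos.2 hθ.2).trans_le
    (one_sub_le_shrunkMinRatio (c := c) (p := propensity q x) hθ.1)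
  have hmax := one_le_shrunkMaxRatio hθ.1 hc hp
  have key := integral_comp_twoSlope hmin (zero_lt_one.trans_le hmax)
    (Or.inr ⟨shrunkMinRatio_le_one hθ.1 hc hp, hmax⟩)
    (integrableOn_realQuantile (hq.integrable x))
  have heq : EqOn (fun τ => realQuantile (outcomeLaw q x)
      (twoSlope (shrunkMinRatio θ c (propensity q x)) (shrunkMaxRatio θ c (propensity q x)) τ))
      (shrunkLower θ c q x) (Ioo 0 1) := fun τ hτ => by
    rw [shrunkLower, shrunkLowerLevel_eq hθ.1 hc hp (Ioo_subset_Icc_self hτ)]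
  exact ⟨key.1.congr_fun heq measurableSet_Ioo,
    (setIntegral_congr_fun measurableSet_Ioo heq).symm.trans key.2⟩

lemma monotone_shrunkUpper (x : Bool) {τ : ℝ} (hτ : τ ∈ Ioo (0 : ℝ) 1) :
    Monotone (fun n => shrunkUpper (contraction n) c q x τ) := fun i j hij => by
  have := hq.isProbabilityMeasure_outcomeLaw x
  have hp := hq.propensity_mem x
  refine monotoneOn_realQuantile (shrunkUpperLevel_mem (contraction_mem i) hc hp hτ)
    (shrunkUpperLevel_mem (contraction_mem j) hc hp hτ) ?_
  have := (upperLevel_mem hc hp (Ioo_subset_Icc_self hτ)).1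
  exact add_le_add_right (mul_le_mul_of_nonneg_right (contraction_mono hij) (by linarith)) _

lemma antitone_shrunkLower (x : Bool) {τ : ℝ} (hτ : τ ∈ Ioo (0 : ℝ) 1) :
    Antitone (fun n => shrunkLower (contraction n) c q x τ) := fun i j hij => by
  have := hq.isProbabilityMeasure_outcomeLaw x
  have hp := hq.propensity_mem x
  refine monotoneOn_realQuantile (shrunkLowerLevel_mem (contraction_mem j) hc hp hτ)
    (shrunkLowerLevel_mem (contraction_mem i) hc hp hτ) ?_
  have := (lowerLevel_mem hc hp (Ioo_subset_Icc_self hτ)).2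
  exact add_le_add_right (mul_le_mul_of_nonpos_right (contraction_mono hij) (by linarith)) _

lemma tendsto_shrunkUpper (x : Bool) {τ : ℝ} (hτ : τ ∈ Ioo (0 : ℝ) 1) :
    Tendsto (fun n => (shrunkUpper (contraction n) c q x τ : EReal)) atTop
      (𝓝 (quantileUpper c q x τ)) := by
  have := hq.isProbabilityMeasure_outcomeLaw x
  have hp := hq.propensity_mem x
  refine tendsto_realQuantile_of_monotone
    (fun n => shrunkUpperLevel_mem (contraction_mem n) hc hp hτ) (fun i j hij => ?_)
    tendsto_contraction_level
  have := (upperLevel_mem hc hp (Ioo_subset_Icc_self hτ)).1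
  exact add_le_add_right (mul_le_mul_of_nonneg_right (contraction_mono hij) (by linarith)) _

lemma tendsto_shrunkLower (x : Bool) {τ : ℝ} (hτ : τ ∈ Ioo (0 : ℝ) 1) :
    Tendsto (fun n => (shrunkLower (contraction n) c q x τ : EReal)) atTop
      (𝓝 (quantileLower c q x τ)) := by
  have := hq.isProbabilityMeasure_outcomeLaw x
  have hp := hq.propensity_mem x
  refine tendsto_realQuantile_of_antitone (hq.strictMonoOn_cdf x) (hq.ordConnected_support x)
    (fun n => shrunkLowerLevel_mem (contraction_mem n) hc hp hτ) (fun i j hij => ?_)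
    tendsto_contraction_level
  have := (lowerLevel_mem hc hp (Ioo_subset_Icc_self hτ)).2
  exact add_le_add_right (mul_le_mul_of_nonpos_right (contraction_mono hij) (by linarith)) _

/-- Comparison with the observed quantile function, which is finite and integrable; it rules out `∞
- ∞` in the gap and later controls positive parts. -/
lemma realQuantile_le_quantileUpper (x : Bool) {τ : ℝ} (hτ : τ ∈ Ioo (0 : ℝ) 1) :
    (realQuantile (outcomeLaw q x) τ : EReal) ≤ quantileUpper c q x τ := by
  have := hq.isProbabilityMeasure_outcomeLaw x
  rw [coe_realQuantile hτ]
  exact quantile_mono _ (upperLevel_mem hc (hq.propensity_mem x) (Ioo_subset_Icc_self hτ)).1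

lemma quantileLower_le_realQuantile (x : Bool) {τ : ℝ} (hτ : τ ∈ Ioo (0 : ℝ) 1) :
    quantileLower c q x τ ≤ (realQuantile (outcomeLaw q x) τ : EReal) := by
  have := hq.isProbabilityMeasure_outcomeLaw x
  rw [coe_realQuantile hτ]
  exact quantile_mono _ (lowerLevel_mem hc (hq.propensity_mem x) (Ioo_subset_Icc_self hτ)).2

lemma quantileUpper_ne_bot (x : Bool) {τ : ℝ} (hτ : τ ∈ Ioo (0 : ℝ) 1) :
    quantileUpper c q x τ ≠ ⊥ :=
  ((EReal.bot_lt_coe _).trans_le (hq.realQuantile_le_quantileUpper hc x hτ)).ne'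

lemma quantileLower_ne_top (x : Bool) {τ : ℝ} (hτ : τ ∈ Ioo (0 : ℝ) 1) :
    quantileLower c q x τ ≠ ⊤ :=
  ((hq.quantileLower_le_realQuantile hc x hτ).trans_lt (EReal.coe_lt_top _)).ne

lemma cqteLower_eq {τ : ℝ} (hτ : τ ∈ Ioo (0 : ℝ) 1) :
    cqteLower c q τ = -quantileGap c q false τ := by
  rw [quantileGap, EReal.neg_sub (Or.inl (hq.quantileUpper_ne_bot hc _ hτ))
    (Or.inr (hq.quantileLower_ne_top hc _ hτ)), add_comm, ← sub_eq_add_neg]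
  rfl

/-- The means of the contracted bounds increase to the mean of the bound. -/
lemma extMean_quantileGap (x : Bool) :
    AEMeasurable (quantileGap c q x) (volume.restrict (Ioo (0 : ℝ) 1)) ∧
    ∫⁻ τ in Ioo (0 : ℝ) 1, (-quantileGap c q x τ).toENNReal ≠ ⊤ ∧
    Tendsto (fun n => ((∫ τ in Ioo (0 : ℝ) 1, (shrunkUpper (contraction n) c q x τ -
      shrunkLower (contraction n) c q (!x) τ) : ℝ) : EReal)) atTop
      (𝓝 (extMean (volume.restrict (Ioo (0 : ℝ) 1)) (quantileGap c q x))) := by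
  refine extMean_of_monotone
    (f := fun n τ => shrunkUpper (contraction n) c q x τ - shrunkLower (contraction n) c q (!x) τ)
    (fun n => (hq.integrableOn_shrunkUpper hc (contraction_mem n) x).1.sub
      (hq.integrableOn_shrunkLower hc (contraction_mem n) (!x)).1) ?_ ?_
  · refine (ae_restrict_iff' measurableSet_Ioo).2 (ae_of_all _ fun τ hτ i j hij => ?_)
    exact sub_le_sub (hq.monotone_shrunkUpper hc x hτ hij) (hq.antitone_shrunkLower hc _ hτ hij)
  · refine (ae_restrict_iff' measurableSet_Ioo).2 (ae_of_all _ fun τ hτ => ?_)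
    simp only [EReal.coe_sub, quantileGap, sub_eq_add_neg (G := EReal)]
    refine (EReal.continuousAt_add (p := (_, _)) ?_ ?_).tendsto.comp
      ((hq.tendsto_shrunkUpper hc x hτ).prodMk_nhds
        ((continuous_neg.tendsto _).comp (hq.tendsto_shrunkLower hc (!x) hτ)))
    · right
      simpa using hq.quantileLower_ne_top hc (!x) hτ
    · left
      exact hq.quantileUpper_ne_bot hc x hτ

lemma extMeanExists_quantileGap (x : Bool) :
    ExtMeanExists (volume.restrict (Ioo (0 : ℝ) 1)) (quantileGap c q x) :=
  ⟨(hq.extMean_quantileGap hc x).1, Or.inr (hq.extMean_quantileGap hc x).2.1⟩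

lemma ae_cqteLower_eq :
    (fun τ => -quantileGap c q false τ) =ᵐ[volume.restrict (Ioo (0 : ℝ) 1)] cqteLower c q :=
  (ae_restrict_iff' measurableSet_Ioo).2 (ae_of_all _ fun _ hτ => (hq.cqteLower_eq hc hτ).symm)

lemma extMeanExists_cqteLower :
    ExtMeanExists (volume.restrict (Ioo (0 : ℝ) 1)) (cqteLower c q) :=
  (hq.extMeanExists_quantileGap hc false).neg.congr_ae (hq.ae_cqteLower_eq hc)

lemma extMeanExists_cqteUpper :
    ExtMeanExists (volume.restrict (Ioo (0 : ℝ) 1)) (cqteUpper c q) :=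
  hq.extMeanExists_quantileGap hc true

lemma cateLower_eq :
    cateLower c q = -extMean (volume.restrict (Ioo (0 : ℝ) 1)) (quantileGap c q false) := by
  rw [← extMean_neg (hq.extMeanExists_quantileGap hc false)]
  exact (extMean_congr_ae (hq.ae_cqteLower_eq hc)).symm

end RegularObserved

end Gap

/-! ### Validity of the bounds -/

section Validity

variable {c : ℝ}

lemma mul_maxRatio {p : ℝ} (hp : p ∈ Ioo (0 : ℝ) 1) : p * maxRatio c p = min (p + c) 1 := by
  have := hp.1.ne'
  rw [maxRatio, mul_min_of_nonneg _ _ hp.1.le]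
  congr 1 <;> field_simp

lemma mul_minRatio {p : ℝ} (hp : p ∈ Ioo (0 : ℝ) 1) : p * minRatio c p = max (p - c) 0 := by
  have := hp.1.ne'
  rw [minRatio, mul_max_of_nonneg _ _ hp.1.le, mul_zero]
  congr 1
  field_simp

lemma real_singleton_mem {π : Measure Bool} [IsProbabilityMeasure π] {p : ℝ}
    (h : |π.real {true} - p| ≤ c) (x : Bool) :
    π.real {x} ∈ Icc (max ((bif x then p else 1 - p) - c) 0)
      (min ((bif x then p else 1 - p) + c) 1) := by
  refine ⟨max_le ?_ measureReal_nonneg, le_min ?_ measureReal_le_one⟩ <;> cases x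
  all_goals
    have hfalse : π.real {false} = 1 - π.real {true} := by
      rw [← probReal_compl_eq_one_sub (measurableSet_singleton true)]
      congr 1
      ext b
      cases b <;> simp
    rw [abs_le] at h
    simp only [cond_true, cond_false, hfalse]
    linarith

variable {ν : Measure Latent} [IsProbabilityMeasure ν]

/-- Under `c`-dependence the observed law of `Y | X = x` has density ratio with respect to the
law of `Y_x` between `minRatio` and `maxRatio`. -/
lemma potLaw_ratio_bounds {x : Bool} (hp : propensity (obsLaw ν) x ∈ Ioo (0 : ℝ) 1)
    (hdep : CDependentAt c ν x) {s : Set ℝ} (hs : MeasurableSet s) :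
    minRatio c (propensity (obsLaw ν) x) * (potLaw ν x).real s ≤
        (outcomeLaw (obsLaw ν) x).real s ∧
      (outcomeLaw (obsLaw ν) x).real s ≤
        maxRatio c (propensity (obsLaw ν) x) * (potLaw ν x).real s := by
  obtain ⟨π, hπ, hcomp, hbound⟩ := hdep
  set p := propensity (obsLaw ν) x with hpdef
  have hcond : p = bif x then ν.real {ω : Latent | ω.2 = true}
      else 1 - ν.real {ω : Latent | ω.2 = true} := by
    cases x
    · rw [hpdef, show false = !true from rfl, propensity_not, propensity_obsLaw]; rfl
    · rw [hpdef, propensity_obsLaw]; rfl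
  have hG : p * (outcomeLaw (obsLaw ν) x).real s =
      ν.real ({ω : Latent | ω.2 = x} ∩ (fun ω : Latent => ω.1 x) ⁻¹' s) := by
    rw [outcomeLaw_obsLaw, measureReal_def, potLawGiven_apply hs, ENNReal.toReal_mul,
      ENNReal.toReal_inv, hpdef, propensity_obsLaw, ← measureReal_def, ← measureReal_def,
      mul_inv_cancel_left₀]
    rw [← propensity_obsLaw]
    exact hp.1.ne'
  -- Disintegration of the joint law of `(Y_x, X)` along `Y_x`.
  have hint : ν.real ({ω : Latent | ω.2 = x} ∩ (fun ω : Latent => ω.1 x) ⁻¹' s) =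
      ∫ y in s, (π y).real {x} ∂(potLaw ν x) := by
    have h1 := congrArg (fun m => m (s ×ˢ {x})) hcomp
    beta_reduce at h1
    rw [Measure.compProd_apply_prod hs (measurableSet_singleton x),
      Measure.map_apply ((measurable_potential x).prodMk measurable_snd)
        (hs.prod (measurableSet_singleton x))] at h1
    rw [integral_eq_lintegral_of_nonneg_ae (ae_of_all _ fun _ => measureReal_nonneg)
      ((π.measurable_coe (measurableSet_singleton x)).ennreal_toReal.aestronglyMeasurable)]
    simp only [measureReal_def, ENNReal.ofReal_toReal (measure_ne_top _ _)]
    rw [h1]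
    congr 2
    ext ω
    simp [and_comm]
  have hi : ∀ y, 0 ≤ (π y).real {x} := fun _ => measureReal_nonneg
  -- The dependence bound is assumed only on the support, which carries the full mass of `potLaw ν
  -- x`.
  have hae : ∀ᵐ y ∂(potLaw ν x).restrict s,
      p * minRatio c p ≤ (π y).real {x} ∧ (π y).real {x} ≤ p * maxRatio c p := by
    refine ae_restrict_of_ae ?_
    filter_upwards [Measure.support_mem_ae (μ := potLaw ν x)] with y hy
    have := real_singleton_mem (hbound y hy) x
    rw [← hcond] at this
    rw [mul_maxRatio hp, mul_minRatio hp]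
    exact this
  have hintble : Integrable (fun y => (π y).real {x}) ((potLaw ν x).restrict s) :=
    Integrable.of_bound (C := 1)
      ((π.measurable_coe (measurableSet_singleton x)).ennreal_toReal.aestronglyMeasurable)
      (ae_of_all _ fun y => by
        rw [Real.norm_of_nonneg (hi y)]
        exact measureReal_le_one)
  rw [← hG] at hint
  have hlo := integral_mono_ae (integrable_const _) hintble (hae.mono fun _ h => h.1)
  have hhi := integral_mono_ae hintble (integrable_const _) (hae.mono fun _ h => h.2)
  rw [← hint, integral_const, measureReal_restrict_apply_univ, smul_eq_mul] at hlo hhi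
  constructor
  · refine le_of_mul_le_mul_left ?_ hp.1
    linarith
  · refine le_of_mul_le_mul_left ?_ hp.1
    linarith

/-- The ratio bounds on the half-line `Iic z` give the lines through `(0, 0)`, those on its
complement the lines through `(1, 1)`. -/
lemma cdf_outcomeLaw_mem {x : Bool} (hc : 0 ≤ c)
    (hp : propensity (obsLaw ν) x ∈ Ioo (0 : ℝ) 1) (hdep : CDependentAt c ν x) (z : ℝ) :
    cdf (outcomeLaw (obsLaw ν) x) z ∈
      Icc (lowerLevel c (propensity (obsLaw ν) x) (cdf (potLaw ν x) z))
        (upperLevel c (propensity (obsLaw ν) x) (cdf (potLaw ν x) z)) := by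
  have := isProbabilityMeasure_outcomeLaw hp.1
  have hmem : cdf (potLaw ν x) z ∈ Icc (0 : ℝ) 1 := ⟨cdf_nonneg _ _, cdf_le_one _ _⟩
  have h1 := potLaw_ratio_bounds hp hdep (measurableSet_Iic (a := z))
  have h2 := potLaw_ratio_bounds hp hdep (measurableSet_Iic (a := z)).compl
  rw [probReal_compl_eq_one_sub measurableSet_Iic,
    probReal_compl_eq_one_sub measurableSet_Iic] at h2
  rw [← cdf_eq_real, ← cdf_eq_real] at h1 h2
  rw [upperLevel_eq hc hp hmem, lowerLevel_eq hc hp hmem]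
  exact ⟨max_le h1.1 (by linarith), le_min h1.2 (by linarith)⟩

/-- Needed where `upperLevel` may have reached the constant `1` and can no longer be inverted; the
equality of supports replaces the inversion there. -/
lemma cdf_eq_one_of_support_eq {ρ σ : Measure ℝ} [IsProbabilityMeasure ρ]
    [IsProbabilityMeasure σ] (h : ρ.support = σ.support) {z : ℝ} (hz : cdf ρ z = 1) :
    cdf σ z = 1 := by
  have hρ : ρ (Iic z)ᶜ = 0 := by
    rw [prob_compl_eq_zero_iff measurableSet_Iic, ← ofReal_cdf, hz, ENNReal.ofReal_one]
  have hσ : σ.support ⊆ Iic z := h ▸ Measure.support_subset_of_isClosed isClosed_Iic hρ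
  rw [cdf_eq_real, measureReal_def, le_antisymm prob_le_one
    ((prob_compl_eq_zero_iff measurableSet_Iic).1 (measure_mono_null
      (compl_subset_compl.2 hσ) Measure.measure_compl_support)).ge]
  rfl

lemma realQuantile_potLaw_le {x : Bool} (hc : 0 ≤ c)
    (hp : propensity (obsLaw ν) x ∈ Ioo (0 : ℝ) 1) (hdep : CDependentAt c ν x)
    (hsupp : (outcomeLaw (obsLaw ν) x).support = (potLaw ν x).support) {τ : ℝ}
    (hτ : τ ∈ Ioo (0 : ℝ) 1) :
    (realQuantile (potLaw ν x) τ : EReal) ≤ quantileUpper c (obsLaw ν) x τ := by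
  have := isProbabilityMeasure_outcomeLaw hp.1
  refine le_sInf ?_
  rintro _ ⟨z, ⟨-, hz⟩, rfl⟩
  rw [EReal.coe_le_coe_iff, realQuantile_le_iff hτ]
  change upperLevel c (propensity (obsLaw ν) x) τ ≤ _ at hz
  rcases (cdf_le_one (outcomeLaw (obsLaw ν) x) z).eq_or_lt with h1 | h1
  · rw [cdf_eq_one_of_support_eq hsupp h1]
    exact hτ.2.le
  -- Below `1` the level is strictly increasing, so a cdf of `Y_x` smaller than `τ` at `z` would
  -- force the observed cdf at `z` below `upperLevel c p τ`.
  · by_contra! hlt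
    have := upperLevel_lt hc hp ⟨cdf_nonneg _ _, cdf_le_one _ _⟩ (Ioo_subset_Icc_self hτ) hlt
      (hz.trans_lt h1)
    linarith [(cdf_outcomeLaw_mem hc hp hdep z).2]

lemma quantileLower_le_potLaw {x : Bool} (hc : 0 ≤ c)
    (hp : propensity (obsLaw ν) x ∈ Ioo (0 : ℝ) 1) (hdep : CDependentAt c ν x)
    (hsupp : (outcomeLaw (obsLaw ν) x).support = (potLaw ν x).support) {τ : ℝ}
    (hτ : τ ∈ Ioo (0 : ℝ) 1) :
    quantileLower c (obsLaw ν) x τ ≤ (realQuantile (potLaw ν x) τ : EReal) :=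
  quantile_le (hsupp ▸ realQuantile_mem_support hτ)
    ((lowerLevel_mono hc hp (Ioo_subset_Icc_self hτ) ⟨cdf_nonneg _ _, cdf_le_one _ _⟩
      (le_cdf_realQuantile hτ)).trans (cdf_outcomeLaw_mem hc hp hdep _).1)

lemma lintegral_potential (x : Bool) {g : ℝ → ℝ≥0∞} (hg : Measurable g) :
    ∫⁻ ω, g (ω.1 x) ∂ν = ∫⁻ τ in Ioo (0 : ℝ) 1, g (realQuantile (potLaw ν x) τ) := by
  rw [← lintegral_map' (f := g) hg.aemeasurable aemeasurable_realQuantile, map_realQuantile,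
    potLaw, lintegral_map hg (measurable_potential x)]

/-- The treatment effect `Y_x - Y_{1-x}` has mean at most that of the quantile gap. -/
lemma lintegral_effect_add_le (hc : 0 ≤ c) (hreg : RegularAt ν)
    (hq : RegularObserved (obsLaw ν)) (hdep : ∀ x, CDependentAt c ν x) (x : Bool) :
    ∫⁻ ω, ENNReal.ofReal (ω.1 x - ω.1 (!x)) ∂ν +
        ∫⁻ τ in Ioo (0 : ℝ) 1, (-quantileGap c (obsLaw ν) x τ).toENNReal ≤
      ∫⁻ ω, ENNReal.ofReal (-(ω.1 x - ω.1 (!x))) ∂ν +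
        ∫⁻ τ in Ioo (0 : ℝ) 1, (quantileGap c (obsLaw ν) x τ).toENNReal := by
  have hsupp : ∀ x, (outcomeLaw (obsLaw ν) x).support = (potLaw ν x).support := fun x => by
    obtain ⟨-, -, -, -, h⟩ := hreg.support_eq x
    rw [outcomeLaw_obsLaw, h]
  have hprob := fun x => hq.isProbabilityMeasure_outcomeLaw x
  have hgap : ∀ {r s τ : ℝ}, (r : EReal) ≤ quantileUpper c (obsLaw ν) x τ →
      quantileLower c (obsLaw ν) (!x) τ ≤ (s : EReal) →
      ((r - s : ℝ) : EReal) ≤ quantileGap c (obsLaw ν) x τ := fun h1 h2 => EReal.sub_le_sub h1 h2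
  have hFU := fun {τ : ℝ} (hτ : τ ∈ Ioo (0 : ℝ) 1) =>
    realQuantile_potLaw_le hc (hq.propensity_mem x) (hdep x) (hsupp x) hτ
  have hFL := fun {τ : ℝ} (hτ : τ ∈ Ioo (0 : ℝ) 1) =>
    quantileLower_le_potLaw hc (hq.propensity_mem (!x)) (hdep (!x)) (hsupp (!x)) hτ
  set U := ∫⁻ τ in Ioo (0 : ℝ) 1, (quantileGap c (obsLaw ν) x τ).toENNReal with hU
  set V := ∫⁻ τ in Ioo (0 : ℝ) 1, (-quantileGap c (obsLaw ν) x τ).toENNReal with hV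
  set f := realQuantile (potLaw ν x)
  set g := realQuantile (potLaw ν (!x))
  by_cases hUtop : U = ⊤
  · simp [hUtop]
  by_cases hN : ∫⁻ ω, ENNReal.ofReal (-(ω.1 x - ω.1 (!x))) ∂ν = ⊤
  · rw [hN, top_add]; exact le_top
  -- With `r` the observed quantile function of the other arm, `f - r ≤ quantileGap`, so the
  -- positive part of `f` is at most that of the gap plus that of `r`. The bound on the negative
  -- part of `g` is symmetric.
  have hf : ∫⁻ τ in Ioo (0 : ℝ) 1, ENNReal.ofReal (f τ) ≠ ⊤ := by
    have hint := lintegral_ofReal_ne_top (integrableOn_realQuantile (hq.integrable (!x)))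
    refine ne_top_of_le_ne_top (ENNReal.add_ne_top.2 ⟨hUtop, hint⟩) ?_
    rw [hU, ← lintegral_add_left' (hq.extMean_quantileGap hc x).1.ereal_toENNReal]
    refine setLIntegral_mono' measurableSet_Ioo fun τ hτ => ?_
    have h := hgap (hFU hτ) (hq.quantileLower_le_realQuantile hc (!x) hτ)
    refine le_trans ?_ (add_le_add_left (EReal.toENNReal_le_toENNReal h) _)
    rw [EReal.real_coe_toENNReal]
    refine le_trans (le_of_eq ?_) ENNReal.ofReal_add_le
    rw [sub_add_cancel]
  have hg : ∫⁻ τ in Ioo (0 : ℝ) 1, ENNReal.ofReal (-g τ) ≠ ⊤ := by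
    have hint := lintegral_ofReal_ne_top (integrableOn_realQuantile (hq.integrable x)).neg
    refine ne_top_of_le_ne_top (ENNReal.add_ne_top.2 ⟨hUtop, hint⟩) ?_
    rw [hU, ← lintegral_add_left' (hq.extMean_quantileGap hc x).1.ereal_toENNReal]
    refine setLIntegral_mono' measurableSet_Ioo fun τ hτ => ?_
    have h := hgap (hq.realQuantile_le_quantileUpper hc x hτ) (hFL hτ)
    refine le_trans ?_ (add_le_add_left (EReal.toENNReal_le_toENNReal h) _)
    rw [EReal.real_coe_toENNReal]
    refine le_trans (le_of_eq ?_) ENNReal.ofReal_add_le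
    rw [Pi.neg_apply, sub_add_eq_add_sub, add_neg_cancel, zero_sub]
  -- `e1` lives on the population and `e2` on the comonotone coupling by quantiles. Their correction
  -- terms `c1` and `c2` depend only on the marginal laws of the potential outcomes, so they agree
  -- and the joint law drops out.
  have e1 := lintegral_sub_add_parts (μ := ν) (measurable_potential x).aemeasurable
    (measurable_potential (!x)).aemeasurable
  have e2 := lintegral_sub_add_parts (μ := volume.restrict (Ioo (0 : ℝ) 1)) (f := f) (g := g)
    aemeasurable_realQuantile aemeasurable_realQuantile
  rw [lintegral_potential x (g := fun y => ENNReal.ofReal (-y)) (by fun_prop),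
    lintegral_potential x (g := fun y => ENNReal.ofReal y) (by fun_prop),
    lintegral_potential (!x) (g := fun y => ENNReal.ofReal (-y)) (by fun_prop),
    lintegral_potential (!x) (g := fun y => ENNReal.ofReal y) (by fun_prop)] at e1
  have hA : ∫⁻ τ in Ioo (0 : ℝ) 1, ENNReal.ofReal (f τ - g τ) ≤ U :=
    setLIntegral_mono_ae' measurableSet_Ioo (ae_of_all _ fun τ hτ => by
      rw [← EReal.real_coe_toENNReal]
      exact EReal.toENNReal_le_toENNReal (hgap (hFU hτ) (hFL hτ)))
  have hB : V ≤ ∫⁻ τ in Ioo (0 : ℝ) 1, ENNReal.ofReal (-(f τ - g τ)) :=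
    setLIntegral_mono_ae' measurableSet_Ioo (ae_of_all _ fun τ hτ => by
      rw [← toENNReal_neg_coe]
      exact EReal.toENNReal_le_toENNReal (EReal.neg_le_neg_iff.2 (hgap (hFU hτ) (hFL hτ))))
  have hc2 := ENNReal.add_ne_top.2 ⟨hf, hg⟩
  set c1 := (∫⁻ τ in Ioo (0 : ℝ) 1, ENNReal.ofReal (-f τ)) +
    ∫⁻ τ in Ioo (0 : ℝ) 1, ENNReal.ofReal (g τ)
  set c2 := (∫⁻ τ in Ioo (0 : ℝ) 1, ENNReal.ofReal (f τ)) +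
    ∫⁻ τ in Ioo (0 : ℝ) 1, ENNReal.ofReal (-g τ)
  change _ + c1 = _ + c2 at e1
  -- Finiteness of `c1` is what allows it to be cancelled.
  have hc1 : c1 ≠ ⊤ := ne_top_of_le_ne_top (ENNReal.add_ne_top.2 ⟨hN, hc2⟩) (e1 ▸ le_add_self)
  refine (ENNReal.add_le_add_iff_right hc1).1 ?_
  calc _ = (∫⁻ ω, ENNReal.ofReal (ω.1 x - ω.1 (!x)) ∂ν + c1) + V := by ring
    _ = ∫⁻ ω, ENNReal.ofReal (-(ω.1 x - ω.1 (!x))) ∂ν + (V + c2) := by rw [e1]; ring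
    _ ≤ ∫⁻ ω, ENNReal.ofReal (-(ω.1 x - ω.1 (!x))) ∂ν + (U + c1) := by
      exact add_le_add_right
        ((add_le_add_left hB c2).trans (e2.symm.le.trans (add_le_add_left hA c1))) _
    _ = _ := by ring

end Validity

/-! ### Populations with given conditional laws of the potential outcomes -/

section Population

/-- Potential outcomes that are independent with laws `J true` and `J false`, and treatment `x`. -/
noncomputable def armLaw (J : Bool → Measure ℝ) (x : Bool) : Measure Latent :=
  ((J true).prod (J false)).map fun z => (fun b => bif b then z.1 else z.2, x)

/-- The population in which `X = x` has probability `p x` and `Y_x` given `X = x'` has law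
`J x' x`. -/
noncomputable def populationLaw (p : Bool → ℝ) (J : Bool → Bool → Measure ℝ) : Measure Latent :=
  ENNReal.ofReal (p true) • armLaw (J true) true + ENNReal.ofReal (p false) • armLaw (J false) false

lemma measurable_arm (x : Bool) :
    Measurable fun z : ℝ × ℝ => ((fun b => bif b then z.1 else z.2, x) : Latent) := by
  refine Measurable.prodMk (measurable_pi_iff.2 fun b => ?_) measurable_const
  cases b
  exacts [measurable_snd, measurable_fst]

lemma armLaw_apply {J : Bool → Measure ℝ} [hJ : ∀ x, IsProbabilityMeasure (J x)] (x x' b : Bool)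
    {s : Set ℝ} (hs : MeasurableSet s) :
    armLaw J x' ({ω : Latent | ω.2 = x} ∩ (fun ω : Latent => ω.1 b) ⁻¹' s) =
      if x' = x then J b s else 0 := by
  rw [armLaw, Measure.map_apply (measurable_arm x')
    ((measurableSet_treatment x).inter (measurable_potential b hs))]
  split_ifs with h
  · subst h
    cases b
    · have : (fun z : ℝ × ℝ => ((fun b => bif b then z.1 else z.2, x') : Latent)) ⁻¹'
          ({ω | ω.2 = x'} ∩ (fun ω => ω.1 false) ⁻¹' s) = univ ×ˢ s := by ext z; simp
      rw [this, Measure.prod_prod, measure_univ, one_mul]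
    · have : (fun z : ℝ × ℝ => ((fun b => bif b then z.1 else z.2, x') : Latent)) ⁻¹'
          ({ω | ω.2 = x'} ∩ (fun ω => ω.1 true) ⁻¹' s) = s ×ˢ univ := by ext z; simp
      rw [this, Measure.prod_prod, measure_univ, mul_one]
  · convert measure_empty (μ := (J true).prod (J false))
    ext z
    simp [h]

variable {p : Bool → ℝ} {J : Bool → Bool → Measure ℝ} [hJ : ∀ x x', IsProbabilityMeasure (J x x')]

lemma populationLaw_apply (x b : Bool) {s : Set ℝ} (hs : MeasurableSet s) :
    populationLaw p J ({ω : Latent | ω.2 = x} ∩ (fun ω : Latent => ω.1 b) ⁻¹' s) =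
      ENNReal.ofReal (p x) * J x b s := by
  rw [populationLaw, Measure.add_apply, Measure.smul_apply, Measure.smul_apply,
    armLaw_apply _ _ _ hs, armLaw_apply _ _ _ hs]
  cases x <;> simp

lemma populationLaw_treatment (x : Bool) :
    populationLaw p J {ω : Latent | ω.2 = x} = ENNReal.ofReal (p x) := by
  simpa using populationLaw_apply (p := p) (J := J) x true MeasurableSet.univ

lemma populationLaw_potential (b : Bool) {s : Set ℝ} (hs : MeasurableSet s) (x : Bool) :
    populationLaw p J ((fun ω : Latent => ω.1 b) ⁻¹' s) =
      ENNReal.ofReal (p x) * J x b s + ENNReal.ofReal (p !x) * J (!x) b s := by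
  rw [← populationLaw_apply x b hs, ← populationLaw_apply (!x) b hs,
    ← measure_inter_add_sdiff _ (measurableSet_treatment x), inter_comm]
  congr 2
  ext ω
  simp only [Set.mem_sdiff, mem_inter_iff, mem_preimage, mem_ofPred_eq]
  rw [and_comm]
  refine and_congr_left fun _ => ?_
  cases ω.2 <;> cases x <;> simp

lemma isProbabilityMeasure_populationLaw (hp : ∀ x, 0 ≤ p x) (hsum : p true + p false = 1) :
    IsProbabilityMeasure (populationLaw p J) := by
  constructor
  have := populationLaw_potential (p := p) (J := J) true MeasurableSet.univ true
  simp only [preimage_univ, measure_univ, mul_one, Bool.not_true] at this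
  rw [this, ← ENNReal.ofReal_add (hp _) (hp _), hsum, ENNReal.ofReal_one]

lemma potLawGiven_populationLaw (b x : Bool) (hp : 0 < p x) :
    potLawGiven (populationLaw p J) b x = J x b := by
  ext s hs
  rw [potLawGiven_apply hs, populationLaw_apply _ _ hs, populationLaw_treatment, ← mul_assoc,
    ENNReal.inv_mul_cancel (by simpa using hp) ENNReal.ofReal_ne_top, one_mul]

lemma potLaw_populationLaw (b x : Bool) :
    potLaw (populationLaw p J) b =
      ENNReal.ofReal (p x) • J x b + ENNReal.ofReal (p !x) • J (!x) b := by
  ext s hs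
  rw [potLaw, Measure.map_apply (measurable_potential b) hs, populationLaw_potential b hs x]
  rfl

lemma ext_of_prod_singleton {m m' : Measure (ℝ × Bool)}
    (h : ∀ x s, MeasurableSet s → m (s ×ˢ {x}) = m' (s ×ˢ {x})) : m = m' := by
  have key : ∀ (n : Measure (ℝ × Bool)) (A : Set (ℝ × Bool)), MeasurableSet A →
      n A = n (((fun y => (y, true)) ⁻¹' A) ×ˢ {true}) +
        n (((fun y => (y, false)) ⁻¹' A) ×ˢ {false}) := by
    intro n A hA
    rw [← measure_union]
    · congr 1
      ext ⟨y, b⟩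
      cases b <;> simp
    · rw [Set.disjoint_left]
      rintro ⟨y, b⟩ h1 h2
      simp_all
    · exact (measurable_prodMk_right hA).prod (measurableSet_singleton _)
  ext A hA
  rw [key m A hA, key m' A hA, h _ _ (measurable_prodMk_right hA),
    h _ _ (measurable_prodMk_right hA)]

lemma obsLaw_populationLaw {q : Measure (ℝ × Bool)} [IsProbabilityMeasure q]
    (hq : ∀ x, 0 < propensity q x) (hp : ∀ x, p x = propensity q x)
    (hJx : ∀ x, J x x = outcomeLaw q x) : obsLaw (populationLaw p J) = q := by
  refine ext_of_prod_singleton fun x s hs => ?_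
  have h1 : observe ⁻¹' (s ×ˢ {x}) = {ω : Latent | ω.2 = x} ∩ (fun ω : Latent => ω.1 x) ⁻¹' s := by
    ext ⟨y, x'⟩
    simp only [observe, mem_preimage, mem_prod, mem_singleton_iff, mem_inter_iff, mem_ofPred_eq]
    rw [and_comm]
    refine and_congr_right fun h => ?_
    subst h
    cases x' <;> simp
  have h2 : s ×ˢ {x} = {o : ℝ × Bool | o.2 = x} ∩ Prod.fst ⁻¹' s := by
    ext o; simp [and_comm]
  rw [obsLaw, Measure.map_apply measurable_observe (hs.prod (measurableSet_singleton x)), h1,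
    populationLaw_apply x x hs, hJx, outcomeLaw_apply hs, hp, h2, propensity, measureReal_def,
    ENNReal.ofReal_toReal (measure_ne_top _ _), ← mul_assoc, ENNReal.mul_inv_cancel
      (ENNReal.toReal_pos_iff.1 (hq x)).1.ne' (measure_ne_top _ _), one_mul]

end Population

/-! ### Continuity and strict monotonicity of distribution functions -/

section Cdf

/-- Continuity of a cdf means absence of atoms, a property that passes to any absolutely continuous
law. -/
lemma continuous_cdf_iff {ρ : Measure ℝ} [IsProbabilityMeasure ρ] :
    Continuous (cdf ρ) ↔ ∀ y, ρ {y} = 0 := by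
  rw [continuous_iff_continuousAt]
  refine forall_congr' fun y => ?_
  rw [(monotone_cdf ρ).continuousAt_iff_leftLim_eq_rightLim, StieltjesFunction.rightLim_eq]
  nth_rewrite 3 [← measure_cdf ρ]
  rw [StieltjesFunction.measure_singleton, ENNReal.ofReal_eq_zero, sub_nonpos]
  exact ⟨fun h => h.ge, fun h => le_antisymm ((monotone_cdf ρ).leftLim_le le_rfl) h⟩

lemma continuous_cdf_of_absolutelyContinuous {ρ σ : Measure ℝ} [IsProbabilityMeasure ρ]
    [IsProbabilityMeasure σ] (h : σ ≪ ρ) (hρ : Continuous (cdf ρ)) : Continuous (cdf σ) :=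
  continuous_cdf_iff.2 fun y => h (continuous_cdf_iff.1 hρ y)

lemma support_eq_of_absolutelyContinuous {ρ σ : Measure ℝ} (h : σ ≪ ρ) (h' : ρ ≪ σ) :
    σ.support = ρ.support :=
  subset_antisymm h.support_mono h'.support_mono

lemma strictMonoOn_cdf_of_absolutelyContinuous {ρ σ : Measure ℝ} [IsProbabilityMeasure ρ]
    [IsProbabilityMeasure σ] (h : ρ ≪ σ) {s : Set ℝ} (hρ : StrictMonoOn (cdf ρ) s) :
    StrictMonoOn (cdf σ) s := fun y hy z hz hyz => by
  have h1 : 0 < ρ.real (Ioc y z) := by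
    rw [measureReal_Ioc_eq_cdf_sub hyz.le]
    exact sub_pos.2 (hρ hy hz hyz)
  have h2 : 0 < σ.real (Ioc y z) := by
    refine ENNReal.toReal_pos (fun h0 => ?_) (measure_ne_top _ _)
    rw [measureReal_def, h h0] at h1
    simp at h1
  rw [measureReal_Ioc_eq_cdf_sub hyz.le] at h2
  exact sub_pos.1 h2

end Cdf

/-! ### Counterfactual laws given by densities -/

section Density

/-- `k` is the density, with respect to the law `ρ` of `Y_x` given `X = x`, of a law of `Y_x` that
is consistent with `c`-dependence and `P(X = x) = p`. -/
structure AdmissibleDensity (c p : ℝ) (ρ : Measure ℝ) (k : ℝ → ℝ) : Prop where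
  measurable : Measurable k
  lt : ∀ y, p < k y
  dependence : ∀ y, |p / k y - p| ≤ c
  bounded : ∃ B, ∀ y, k y ≤ B
  integral_eq_one : ∫ y, k y ∂ρ = 1

/-- The law of `Y_x` given `X ≠ x` when that of `Y_x` given `X = x` is `ρ` and that of `Y_x` has
density `k` with respect to `ρ`. -/
noncomputable def counterLaw (p : ℝ) (ρ : Measure ℝ) (k : ℝ → ℝ) : Measure ℝ :=
  ρ.withDensity fun y => ENNReal.ofReal ((k y - p) / (1 - p))

variable {c p : ℝ} {ρ : Measure ℝ} {k : ℝ → ℝ}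

lemma counterLaw_absolutelyContinuous : counterLaw p ρ k ≪ ρ :=
  withDensity_absolutelyContinuous _ _

namespace AdmissibleDensity

variable (hk : AdmissibleDensity c p ρ k) (hp : p ∈ Ioo (0 : ℝ) 1)
include hk

lemma integrable [IsFiniteMeasure ρ] (hp : p ∈ Ioo (0 : ℝ) 1) : Integrable k ρ := by
  obtain ⟨B, hB⟩ := hk.bounded
  refine Integrable.of_bound (C := B) hk.measurable.aestronglyMeasurable (ae_of_all _ fun y => ?_)
  rw [Real.norm_of_nonneg (hp.1.trans (hk.lt y)).le]
  exact hB y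

include hp

lemma pos (y : ℝ) : 0 < k y := hp.1.trans (hk.lt y)

lemma counter_pos (y : ℝ) : 0 < (k y - p) / (1 - p) :=
  div_pos (sub_pos.2 (hk.lt y)) (sub_pos.2 hp.2)

lemma absolutelyContinuous_counterLaw : ρ ≪ counterLaw p ρ k :=
  withDensity_absolutelyContinuous'
    (((hk.measurable.sub_const p).div_const (1 - p)).ennreal_ofReal.aemeasurable)
    (ae_of_all _ fun y => by simpa using hk.counter_pos hp y)

lemma isProbabilityMeasure_counterLaw [IsProbabilityMeasure ρ] :
    IsProbabilityMeasure (counterLaw p ρ k) := by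
  have hi : Integrable (fun y => (k y - p) / (1 - p)) ρ :=
    ((hk.integrable hp).sub (integrable_const p)).div_const _
  constructor
  rw [counterLaw, withDensity_apply _ MeasurableSet.univ, Measure.restrict_univ,
    ← ofReal_integral_eq_lintegral_ofReal hi (ae_of_all _ fun y => (hk.counter_pos hp y).le)]
  rw [integral_div, integral_sub (hk.integrable hp) (integrable_const p), hk.integral_eq_one]
  simp [div_self (sub_pos.2 hp.2).ne']

/-- The density `(k - p) / (1 - p)` of `counterLaw` is forced by this mixture identity. -/
lemma smul_add_counterLaw :
    ENNReal.ofReal p • ρ + ENNReal.ofReal (1 - p) • counterLaw p ρ k =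
      ρ.withDensity fun y => ENNReal.ofReal (k y) := by
  have h1p := sub_pos.2 hp.2
  rw [counterLaw, ← withDensity_const, ← withDensity_smul _
    ((hk.measurable.sub_const p).div_const (1 - p)).ennreal_ofReal,
    ← withDensity_add_left measurable_const]
  congr 1
  ext y
  simp only [Pi.add_apply, Pi.smul_apply, smul_eq_mul]
  rw [← ENNReal.ofReal_mul h1p.le, ← ENNReal.ofReal_add hp.1.le
    (mul_nonneg h1p.le (hk.counter_pos hp y).le), mul_div_cancel₀ _ h1p.ne']
  congr 1
  ring

end AdmissibleDensity

end Density

/-! ### A population with given observed law and given densities of the potential outcomes -/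

section Witness

/-- The laws of the potential outcomes given `X = x'`. -/
noncomputable def witnessArm (q : Measure (ℝ × Bool)) (k : Bool → ℝ → ℝ) (x' x : Bool) :
    Measure ℝ :=
  if x' = x then outcomeLaw q x else counterLaw (propensity q x) (outcomeLaw q x) (k x)

noncomputable def witness (q : Measure (ℝ × Bool)) (k : Bool → ℝ → ℝ) : Measure Latent :=
  populationLaw (propensity q) (witnessArm q k)

variable {c : ℝ} {q : Measure (ℝ × Bool)} {k : Bool → ℝ → ℝ}

lemma witnessArm_self (x : Bool) : witnessArm q k x x = outcomeLaw q x := if_pos rfl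

lemma witnessArm_not (x : Bool) :
    witnessArm q k (!x) x = counterLaw (propensity q x) (outcomeLaw q x) (k x) :=
  if_neg (by cases x <;> simp)

variable (hq : RegularObserved q)
  (hk : ∀ x, AdmissibleDensity c (propensity q x) (outcomeLaw q x) (k x))
include hq hk

lemma isProbabilityMeasure_witnessArm (x' x : Bool) :
    IsProbabilityMeasure (witnessArm q k x' x) := by
  have := hq.isProbabilityMeasure_outcomeLaw x
  unfold witnessArm
  split_ifs
  · exact this
  · exact (hk x).isProbabilityMeasure_counterLaw (hq.propensity_mem x)

lemma isProbabilityMeasure_witness : IsProbabilityMeasure (witness q k) := by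
  have := hq.isProbabilityMeasure
  have := isProbabilityMeasure_witnessArm hq hk
  refine isProbabilityMeasure_populationLaw (fun x => (hq.propensity_mem x).1.le) ?_
  rw [show false = !true from rfl, propensity_not]
  ring

lemma potLaw_witness (x : Bool) : potLaw (witness q k) x =
    (outcomeLaw q x).withDensity fun y => ENNReal.ofReal (k x y) := by
  have := hq.isProbabilityMeasure
  have := isProbabilityMeasure_witnessArm hq hk
  rw [witness, potLaw_populationLaw x x, witnessArm_self, witnessArm_not, propensity_not,
    (hk x).smul_add_counterLaw (hq.propensity_mem x)]

lemma potLawGiven_witness (x x' : Bool) :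
    potLawGiven (witness q k) x x' = witnessArm q k x' x := by
  have := isProbabilityMeasure_witnessArm hq hk
  exact potLawGiven_populationLaw x x' (hq.propensity_mem x').1

lemma obsLaw_witness : obsLaw (witness q k) = q := by
  have := hq.isProbabilityMeasure
  have := isProbabilityMeasure_witnessArm hq hk
  exact obsLaw_populationLaw (fun x => (hq.propensity_mem x).1) (fun _ => rfl)
    (fun x => witnessArm_self x)

lemma witnessArm_absolutelyContinuous (x' x : Bool) :
    witnessArm q k x' x ≪ outcomeLaw q x ∧ outcomeLaw q x ≪ witnessArm q k x' x := by
  unfold witnessArm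
  split_ifs
  · exact ⟨Measure.AbsolutelyContinuous.rfl, Measure.AbsolutelyContinuous.rfl⟩
  · exact ⟨counterLaw_absolutelyContinuous,
      (hk x).absolutelyContinuous_counterLaw (hq.propensity_mem x)⟩

lemma potLaw_witness_support (x : Bool) :
    (potLaw (witness q k) x).support = (outcomeLaw q x).support := by
  rw [potLaw_witness hq hk]
  exact support_eq_of_absolutelyContinuous (withDensity_absolutelyContinuous _ _)
    (withDensity_absolutelyContinuous' (hk x).measurable.ennreal_ofReal.aemeasurable
      (ae_of_all _ fun y => by simpa using (hk x).pos (hq.propensity_mem x) y))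

lemma regularAt_witness : RegularAt (witness q k) := by
  have := hq.isProbabilityMeasure
  have := isProbabilityMeasure_witnessArm hq hk
  have := hq.isProbabilityMeasure_outcomeLaw
  have hsupp : ∀ x' x, (witnessArm q k x' x).support = (outcomeLaw q x).support := fun x' x =>
    support_eq_of_absolutelyContinuous (witnessArm_absolutelyContinuous hq hk x' x).1
      (witnessArm_absolutelyContinuous hq hk x' x).2
  refine ⟨fun x x' => ?_, fun x x' => ?_, fun x => ?_, ?_⟩
  · rw [potLawGiven_witness hq hk]
    exact continuous_cdf_of_absolutelyContinuous
      (witnessArm_absolutelyContinuous hq hk x' x).1 (hq.continuous_cdf x)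
  · rw [potLawGiven_witness hq hk, hsupp]
    exact strictMonoOn_cdf_of_absolutelyContinuous
      (witnessArm_absolutelyContinuous hq hk x' x).2 (hq.strictMonoOn_cdf x)
  · obtain ⟨a, b, hab, h⟩ := hq.support_eq x
    refine ⟨a, b, hab, by rw [potLaw_witness_support hq hk, h], fun x' => ?_⟩
    rw [potLawGiven_witness hq hk, hsupp, potLaw_witness_support hq hk]
  · rw [← propensity_obsLaw, obsLaw_witness hq hk]
    exact hq.propensity_mem true

lemma cDependentAt_witness (x : Bool) : CDependentAt c (witness q k) x := by
  have := hq.isProbabilityMeasure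
  have := isProbabilityMeasure_witness hq hk
  have := isProbabilityMeasure_witnessArm hq hk
  have := hq.isProbabilityMeasure_outcomeLaw
  have hp := hq.propensity_mem x
  set p := propensity q x with hpdef
  set r : ℝ → ℝ := fun y => p / k x y with hr
  have hkpos := (hk x).pos hp
  have hr0 : ∀ y, 0 ≤ r y := fun y => div_nonneg hp.1.le (hkpos y).le
  have hr1 : ∀ y, 0 ≤ 1 - r y := fun y =>
    sub_nonneg.2 ((div_le_one (hkpos y)).2 ((hk x).lt y).le)
  have hrm : Measurable r := measurable_const.div (hk x).measurable
  -- By Bayes' rule `P(X = x | Y_x = y) = p / k y`, since `Y_x` has density `k` with respect to its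
  -- law given `X = x`.
  let π : Kernel ℝ Bool :=
    ⟨fun y => ENNReal.ofReal (r y) • Measure.dirac x + ENNReal.ofReal (1 - r y) • Measure.dirac (!x),
      Measure.measurable_of_measurable_coe _ fun s _ => by
        simp only [Measure.add_apply, Measure.smul_apply, smul_eq_mul]
        fun_prop⟩
  have hπ : ∀ y, π y = ENNReal.ofReal (r y) • Measure.dirac x +
    ENNReal.ofReal (1 - r y) • Measure.dirac (!x) := fun _ => rfl
  have hπx : ∀ y, π y {x} = ENNReal.ofReal (r y) := fun y => by rw [hπ]; cases x <;> simp
  have hπn : ∀ y, π y {!x} = ENNReal.ofReal (1 - r y) := fun y => by rw [hπ]; cases x <;> simp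
  have hmk : IsMarkovKernel π := ⟨fun y => ⟨by
    rw [hπ]
    simp [← ENNReal.ofReal_add (hr0 y) (hr1 y)]⟩⟩
  refine ⟨π, hmk, ext_of_prod_singleton fun b s hs => ?_, fun y _ => ?_⟩
  · rw [Measure.compProd_apply_prod hs (measurableSet_singleton b),
      Measure.map_apply ((measurable_potential x).prodMk measurable_snd)
        (hs.prod (measurableSet_singleton b)), potLaw_witness hq hk]
    have hset : (fun ω : Latent => (ω.1 x, ω.2)) ⁻¹' (s ×ˢ {b}) =
        {ω : Latent | ω.2 = b} ∩ (fun ω : Latent => ω.1 x) ⁻¹' s := by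
      ext ω; simp [and_comm]
    rw [hset, witness, populationLaw_apply b x hs,
      setLIntegral_withDensity_eq_setLIntegral_mul _ (hk x).measurable.ennreal_ofReal
        (π.measurable_coe (measurableSet_singleton b)) hs]
    simp only [Pi.mul_apply]
    have hb : b = x ∨ b = !x := by cases b <;> cases x <;> simp
    rcases hb with rfl | rfl
    · rw [witnessArm_self]
      simp only [hπx, ← ENNReal.ofReal_mul (hkpos _).le, hr, mul_div_cancel₀ _ (hkpos _).ne']
      rw [setLIntegral_const]
    · rw [witnessArm_not, counterLaw, withDensity_apply _ hs, propensity_not, ← hpdef,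
        ← lintegral_const_mul _
          ((hk x).measurable.sub_const p |>.div_const (1 - p)).ennreal_ofReal]
      refine lintegral_congr fun y => ?_
      rw [hπn, ← ENNReal.ofReal_mul (hkpos _).le, ← ENNReal.ofReal_mul (sub_pos.2 hp.2).le,
        mul_div_cancel₀ _ (sub_pos.2 hp.2).ne']
      congr 1
      rw [hr]
      field_simp [(hkpos y).ne']
  · have hd := (hk x).dependence y
    rw [← propensity_obsLaw, obsLaw_witness hq hk]
    cases x
    · have h1 : (π y).real {true} = 1 - r y := by
        rw [measureReal_def, ← Bool.not_false, hπn, ENNReal.toReal_ofReal (hr1 y)]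
      rw [h1, show propensity q true = 1 - p by rw [hpdef, ← propensity_not]; rfl,
        sub_sub_sub_cancel_left, abs_sub_comm]
      exact hd
    · rw [measureReal_def, hπx, ENNReal.toReal_ofReal (hr0 y)]
      exact hd

lemma integral_potential_witness (x : Bool) :
    Integrable (fun ω : Latent => ω.1 x) (witness q k) ∧
      ∫ ω : Latent, ω.1 x ∂(witness q k) = ∫ y, y * k x y ∂(outcomeLaw q x) := by
  have hpos := (hk x).pos (hq.propensity_mem x)
  obtain ⟨B, hB⟩ := (hk x).bounded
  have hint : Integrable (fun y => y * k x y) (outcomeLaw q x) :=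
    (hq.integrable x).mul_bdd (c := B) (hk x).measurable.aestronglyMeasurable
      (ae_of_all _ fun y => by rw [Real.norm_of_nonneg (hpos y).le]; exact hB y)
  have hmap := potLaw_witness hq hk x
  have h2 : ∀ y, (ENNReal.ofReal (k x y)).toReal • y = y * k x y := fun y => by
    rw [ENNReal.toReal_ofReal (hpos y).le, smul_eq_mul, mul_comm]
  constructor
  · have : Integrable (fun y : ℝ => y) (potLaw (witness q k) x) := by
      rw [hmap, integrable_withDensity_iff_integrable_smul' (hk x).measurable.ennreal_ofReal
        (ae_of_all _ fun _ => ENNReal.ofReal_lt_top)]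
      simpa only [h2] using hint
    exact (integrable_map_measure measurable_id.aestronglyMeasurable
      (measurable_potential x).aemeasurable).1 this
  · rw [← integral_map (f := fun y : ℝ => y) (measurable_potential x).aemeasurable
      measurable_id.aestronglyMeasurable]
    change ∫ y, y ∂(potLaw (witness q k) x) = _
    rw [hmap, integral_withDensity_eq_integral_toReal_smul (hk x).measurable.ennreal_ofReal
      (ae_of_all _ fun _ => ENNReal.ofReal_lt_top)]
    simp only [h2]

end Witness

/-! ### Densities that attain the contracted bounds -/

section MixDensity

/-- A mixture of the densities that attain the contracted lower and upper bounds. -/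
noncomputable def mixDensity (θ c t p u : ℝ) : ℝ :=
  (1 - t) * slopeDensity (shrunkMinRatio θ c p) (shrunkMaxRatio θ c p) u +
    t * slopeDensity (shrunkMaxRatio θ c p) (shrunkMinRatio θ c p) u

lemma measurable_slopeDensity {α : Type*} [MeasurableSpace α] {s t u : α → ℝ} (hs : Measurable s)
    (ht : Measurable t) (hu : Measurable u) :
    Measurable fun a => slopeDensity (s a) (t a) (u a) := by
  unfold slopeDensity kink
  exact Measurable.ite (measurableSet_le hu (hs.mul ((measurable_const.sub ht).div (hs.sub ht))))
    hs.inv ht.inv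

lemma measurable_mixDensity {α : Type*} [MeasurableSpace α] (θ c t : ℝ) {p u : α → ℝ}
    (hp : Measurable p) (hu : Measurable u) : Measurable fun a => mixDensity θ c t (p a) (u a) := by
  have h1 : Measurable fun a => shrunkMinRatio θ c (p a) := by
    unfold shrunkMinRatio minRatio; fun_prop
  have h2 : Measurable fun a => shrunkMaxRatio θ c (p a) := by
    unfold shrunkMaxRatio maxRatio; fun_prop
  exact ((measurable_slopeDensity h1 h2 hu).const_mul _).add
    ((measurable_slopeDensity h2 h1 hu).const_mul _)

variable {θ c t p : ℝ}

lemma mixDensity_mem (hθ : θ ∈ Ico (0 : ℝ) 1) (hc : 0 ≤ c) (ht : t ∈ Icc (0 : ℝ) 1)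
    (hp : p ∈ Ioo (0 : ℝ) 1) (u : ℝ) :
    mixDensity θ c t p u ∈ Icc (shrunkMaxRatio θ c p)⁻¹ (shrunkMinRatio θ c p)⁻¹ := by
  have hlo := (sub_pos.2 hθ.2).trans_le (one_sub_le_shrunkMinRatio (c := c) (p := p) hθ.1)
  have hle := (shrunkMinRatio_le_one hθ.1 hc hp).trans (one_le_shrunkMaxRatio hθ.1 hc hp)
  exact (convex_Icc _ _) (slopeDensity_mem hlo (left_mem_Icc.2 hle) (right_mem_Icc.2 hle) u)
    (slopeDensity_mem hlo (right_mem_Icc.2 hle) (left_mem_Icc.2 hle) u)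
    (sub_nonneg.2 ht.2) ht.1 (by ring)

/-- The quantile transform together with `cdf ρ (realQuantile ρ u) = u`; a density on levels becomes
a density on outcomes. -/
lemma integral_mul_comp_cdf {ρ : Measure ℝ} [IsProbabilityMeasure ρ] (hρ : Continuous (cdf ρ))
    {g D : ℝ → ℝ} (hg : Measurable g) (hD : Measurable D) :
    ∫ y, g y * D (cdf ρ y) ∂ρ = ∫ u in Ioo (0 : ℝ) 1, g (realQuantile ρ u) * D u := by
  have hm : AEStronglyMeasurable (fun y => g y * D (cdf ρ y))
      ((volume.restrict (Ioo (0 : ℝ) 1)).map (realQuantile ρ)) :=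
    (hg.mul (hD.comp (cdf ρ).mono.measurable)).aestronglyMeasurable
  have key := integral_map aemeasurable_realQuantile hm
  rw [map_realQuantile] at key
  rw [key]
  exact setIntegral_congr_fun measurableSet_Ioo fun u hu => by
    simp only [cdf_realQuantile hρ hu]

/-- The density of `Y_x` in the population that interpolates between the contracted bounds. -/
noncomputable def boundDensity (θ c t : ℝ) (q : Measure (ℝ × Bool)) (x : Bool) (y : ℝ) : ℝ :=
  -- The weight is reversed for `Y_0`, so that raising `t` moves `Y_1` to its upper bound and `Y_0`
  -- to its lower one. Writing `real (Iic y)` instead of `cdf` keeps joint measurability in `(w, y)`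
  -- available even where `outcomeLaw` is not a probability measure.
  mixDensity θ c (bif x then t else 1 - t) (propensity q x) ((outcomeLaw q x).real (Iic y))

lemma bif_mem (ht : t ∈ Icc (0 : ℝ) 1) (x : Bool) : (bif x then t else 1 - t) ∈ Icc (0 : ℝ) 1 := by
  cases x
  exacts [⟨sub_nonneg.2 ht.2, sub_le_self _ ht.1⟩, ht]

namespace RegularObserved

variable {q : Measure (ℝ × Bool)} (hq : RegularObserved q) (hc : 0 ≤ c)
  (hθ : θ ∈ Ico (0 : ℝ) 1) (ht : t ∈ Icc (0 : ℝ) 1)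
include hq

lemma boundDensity_eq (x : Bool) : boundDensity θ c t q x = fun y =>
    mixDensity θ c (bif x then t else 1 - t) (propensity q x) (cdf (outcomeLaw q x) y) := by
  have := hq.isProbabilityMeasure_outcomeLaw x
  ext y
  rw [boundDensity, cdf_eq_real]

include hc hθ

lemma integral_mul_boundDensity (x : Bool) {g : ℝ → ℝ} (hg : Measurable g)
    (hint : IntegrableOn (fun u => g (realQuantile (outcomeLaw q x) u)) (Ioo 0 1)) :
    ∫ y, g y * boundDensity θ c t q x y ∂(outcomeLaw q x) =
      (1 - bif x then t else 1 - t) * (∫ u in Ioo 0 1, g (realQuantile (outcomeLaw q x) u) *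
        slopeDensity (shrunkMinRatio θ c (propensity q x))
          (shrunkMaxRatio θ c (propensity q x)) u) +
      (bif x then t else 1 - t) * ∫ u in Ioo 0 1, g (realQuantile (outcomeLaw q x) u) *
        slopeDensity (shrunkMaxRatio θ c (propensity q x))
          (shrunkMinRatio θ c (propensity q x)) u := by
  have := hq.isProbabilityMeasure_outcomeLaw x
  have hp := hq.propensity_mem x
  rw [hq.boundDensity_eq x]
  refine (integral_mul_comp_cdf (hq.continuous_cdf x) hg
    (measurable_mixDensity _ _ _ measurable_const measurable_id)).trans ?_
  have hlo := (sub_pos.2 hθ.2).trans_le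
    (one_sub_le_shrunkMinRatio (c := c) (p := propensity q x) hθ.1)
  have hle := (shrunkMinRatio_le_one hθ.1 hc hp).trans (one_le_shrunkMaxRatio hθ.1 hc hp)
  have hD : ∀ {s r : ℝ}, s ∈ Icc (shrunkMinRatio θ c (propensity q x))
      (shrunkMaxRatio θ c (propensity q x)) → r ∈ Icc (shrunkMinRatio θ c (propensity q x))
      (shrunkMaxRatio θ c (propensity q x)) →
      IntegrableOn (fun u => g (realQuantile (outcomeLaw q x) u) * slopeDensity s r u) (Ioo 0 1) :=
    fun {s r} hs hr => hint.mul_bdd (c := (shrunkMinRatio θ c (propensity q x))⁻¹)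
      (measurable_slopeDensity measurable_const measurable_const
        measurable_id).aestronglyMeasurable
      (ae_of_all _ fun u => by
        have := slopeDensity_mem hlo hs hr u
        rw [Real.norm_of_nonneg ((inv_nonneg.2 (hlo.le.trans hle)).trans this.1)]
        exact this.2)
  rw [← integral_const_mul, ← integral_const_mul, ← integral_add
    ((hD (left_mem_Icc.2 hle) (right_mem_Icc.2 hle)).const_mul _)
    ((hD (right_mem_Icc.2 hle) (left_mem_Icc.2 hle)).const_mul _)]
  refine integral_congr_ae (ae_of_all _ fun u => ?_)
  simp only [mixDensity, id]
  ring

include ht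

lemma boundDensity_mem (x : Bool) (y : ℝ) : boundDensity θ c t q x y ∈
    Icc (shrunkMaxRatio θ c (propensity q x))⁻¹ (shrunkMinRatio θ c (propensity q x))⁻¹ :=
  mixDensity_mem hθ hc (bif_mem ht x) (hq.propensity_mem x) _

/-- The bound does not involve the propensity, hence is uniform in the covariate; integrability of
the effect over `W` rests on it. -/
lemma boundDensity_le (x : Bool) (y : ℝ) : boundDensity θ c t q x y ≤ (1 - θ)⁻¹ :=
  (hq.boundDensity_mem hc hθ ht x y).2.trans
    (inv_anti₀ (sub_pos.2 hθ.2) (one_sub_le_shrunkMinRatio hθ.1))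

lemma admissible_boundDensity (x : Bool) :
    AdmissibleDensity c (propensity q x) (outcomeLaw q x) (boundDensity θ c t q x) := by
  have := hq.isProbabilityMeasure_outcomeLaw x
  have hp := hq.propensity_mem x
  have hlo := (sub_pos.2 hθ.2).trans_le
    (one_sub_le_shrunkMinRatio (c := c) (p := propensity q x) hθ.1)
  have hmax := one_le_shrunkMaxRatio hθ.1 hc hp
  have hhi := zero_lt_one.trans_le hmax
  have hmin := shrunkMinRatio_le_one hθ.1 hc hp
  have hmem := hq.boundDensity_mem hc hθ ht x
  refine ⟨?_, fun y => ?_, fun y => ?_, ⟨_, hq.boundDensity_le hc hθ ht x⟩, ?_⟩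
  · rw [hq.boundDensity_eq x]
    exact measurable_mixDensity _ _ _ measurable_const (cdf _).mono.measurable
  · refine lt_of_lt_of_le ?_ (hmem y).1
    rw [lt_inv_comm₀ hp.1 hhi, ← one_div, lt_div_iff₀ hp.1, mul_comm]
    exact mul_shrunkMaxRatio_lt_one hθ hp
  · have hpos : 0 < boundDensity θ c t q x y := (inv_pos.2 hhi).trans_le (hmem y).1
    have h1 : (boundDensity θ c t q x y)⁻¹ ≤ shrunkMaxRatio θ c (propensity q x) :=
      inv_le_of_inv_le₀ hhi (hmem y).1
    have h2 : shrunkMinRatio θ c (propensity q x) ≤ (boundDensity θ c t q x y)⁻¹ :=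
      (le_inv_comm₀ hpos hlo).1 (hmem y).2
    have h3 := mul_le_mul_of_nonneg_left h1 hp.1.le
    have h4 := mul_le_mul_of_nonneg_left h2 hp.1.le
    have h5 := mul_shrunkMaxRatio_le hθ hc hp
    have h6 := le_mul_shrunkMinRatio hθ hc hp
    rw [div_eq_mul_inv, abs_le]
    constructor <;> linarith
  -- Total mass one: each `slopeDensity` is the density of a bijective image of Lebesgue measure on
  -- the unit interval, as the change of variables with `f = 1` shows.
  · have hone : IntegrableOn (fun _ : ℝ => (1 : ℝ)) (Ioo 0 1) :=
      integrable_const (1 : ℝ) (μ := volume.restrict (Ioo (0 : ℝ) 1))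
    have key := hq.integral_mul_boundDensity (t := t) hc hθ x (g := fun _ => 1) measurable_const
      hone
    have e1 := (integral_comp_twoSlope hlo hhi (Or.inr ⟨hmin, hmax⟩) hone).2
    have e2 := (integral_comp_twoSlope hhi hlo (Or.inl ⟨hmin, hmax⟩) hone).2
    rw [← e1, ← e2] at key
    simpa using key

/-- The mean of `Y_x` in the interpolating population. -/
lemma integral_potential_boundDensity (x : Bool) :
    Integrable (fun ω : Latent => ω.1 x) (witness q (boundDensity θ c t q)) ∧
      ∫ ω : Latent, ω.1 x ∂(witness q (boundDensity θ c t q)) =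
        (1 - bif x then t else 1 - t) * (∫ τ in Ioo 0 1, shrunkLower θ c q x τ) +
          (bif x then t else 1 - t) * ∫ τ in Ioo 0 1, shrunkUpper θ c q x τ := by
  have := hq.isProbabilityMeasure_outcomeLaw x
  have h := integral_potential_witness hq (hq.admissible_boundDensity hc hθ ht) x
  refine ⟨h.1, h.2.trans ?_⟩
  rw [hq.integral_mul_boundDensity hc hθ x (g := fun y => y) measurable_id
    (integrableOn_realQuantile (hq.integrable x)), (hq.integrableOn_shrunkLower hc hθ x).2,
    (hq.integrableOn_shrunkUpper hc hθ x).2]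

lemma lintegral_enorm_potential_le (x : Bool) :
    ∫⁻ ω : Latent, ‖ω.1 x‖ₑ ∂(witness q (boundDensity θ c t q)) ≤
      ENNReal.ofReal (1 - θ)⁻¹ * ∫⁻ y, ‖y‖ₑ ∂(outcomeLaw q x) := by
  have hk := hq.admissible_boundDensity hc hθ ht
  rw [← lintegral_map (f := fun y : ℝ => ‖y‖ₑ) measurable_enorm (measurable_potential x)]
  change ∫⁻ y, ‖y‖ₑ ∂(potLaw (witness q (boundDensity θ c t q)) x) ≤ _
  rw [potLaw_witness hq hk, lintegral_withDensity_eq_lintegral_mul _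
    (hk x).measurable.ennreal_ofReal measurable_enorm, ← lintegral_const_mul _ measurable_enorm]
  exact lintegral_mono fun y => mul_le_mul_left
    (ENNReal.ofReal_le_ofReal (hq.boundDensity_le hc hθ ht x y)) _

end RegularObserved

/-- The mean of the difference between the contracted upper bound of one quantile function and
the contracted lower bound of the other. -/
noncomputable def gapMean (θ c : ℝ) (q : Measure (ℝ × Bool)) (x : Bool) : ℝ :=
  ∫ τ in Ioo (0 : ℝ) 1, (shrunkUpper θ c q x τ - shrunkLower θ c q (!x) τ)

/-- Affine in `t`, running from the contracted lower bound at `t = 0` to the contracted upper bound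
at `t = 1`. -/
lemma RegularObserved.integral_effect_witness {q : Measure (ℝ × Bool)} (hq : RegularObserved q)
    (hc : 0 ≤ c) (hθ : θ ∈ Ico (0 : ℝ) 1) (ht : t ∈ Icc (0 : ℝ) 1) :
    ∫ ω : Latent, (ω.1 true - ω.1 false) ∂(witness q (boundDensity θ c t q)) =
      t * gapMean θ c q true - (1 - t) * gapMean θ c q false := by
  have h1 := hq.integral_potential_boundDensity hc hθ ht true
  have h0 := hq.integral_potential_boundDensity hc hθ ht false
  rw [integral_sub h1.1 h0.1, h1.2, h0.2, gapMean, gapMean,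
    integral_sub (hq.integrableOn_shrunkUpper hc hθ _).1 (hq.integrableOn_shrunkLower hc hθ _).1,
    integral_sub (hq.integrableOn_shrunkUpper hc hθ _).1 (hq.integrableOn_shrunkLower hc hθ _).1]
  simp only [cond_true, cond_false, Bool.not_true, Bool.not_false]
  ring

end MixDensity

/-! ### Measurable dependence on the covariate -/

section Kernels

variable {W : Type*} [MeasurableSpace W]

lemma measurable_outcomeLaw (η : Kernel W (ℝ × Bool)) (x : Bool) :
    Measurable fun w => outcomeLaw (η w) x := by
  refine Measure.measurable_of_measurable_coe _ fun s hs => ?_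
  simp only [outcomeLaw_apply hs]
  exact (η.measurable_coe (measurableSet_snd_eq x)).inv.mul
    (η.measurable_coe ((measurableSet_snd_eq x).inter (measurable_fst hs)))

/-- The conditional law of the outcome given the treatment, as a kernel. -/
noncomputable def outcomeKernel (η : Kernel W (ℝ × Bool)) (x : Bool) : Kernel W ℝ :=
  ⟨fun w => outcomeLaw (η w) x, measurable_outcomeLaw η x⟩

instance (η : Kernel W (ℝ × Bool)) (x : Bool) : IsFiniteKernel (outcomeKernel η x) :=
  ⟨⟨1, ENNReal.one_lt_top, fun w => by
    change outcomeLaw (η w) x univ ≤ 1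
    rw [outcomeLaw_apply MeasurableSet.univ, preimage_univ, inter_univ]
    exact ENNReal.inv_mul_le_one _⟩⟩

lemma measurable_propensity (η : Kernel W (ℝ × Bool)) (x : Bool) :
    Measurable fun w => propensity (η w) x :=
  (η.measurable_coe (measurableSet_snd_eq x)).ennreal_toReal

lemma measurable_outcomeLaw_Iic (η : Kernel W (ℝ × Bool)) (x : Bool) :
    Measurable fun z : W × ℝ => (outcomeLaw (η z.1) x).real (Iic z.2) := by
  have hset : MeasurableSet {v : (W × ℝ) × ℝ | v.2 ≤ v.1.2} :=
    measurableSet_le measurable_snd measurable_fst.snd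
  exact (Kernel.measurable_kernel_prodMk_left
    (κ := Kernel.prodMkRight ℝ (outcomeKernel η x)) hset).ennreal_toReal

lemma measurable_boundDensity (θ c t : ℝ) (η : Kernel W (ℝ × Bool)) (x : Bool) :
    Measurable fun z : W × ℝ => boundDensity θ c t (η z.1) x z.2 :=
  measurable_mixDensity _ _ _ ((measurable_propensity η x).comp measurable_fst)
    (measurable_outcomeLaw_Iic η x)

/-- The laws of the potential outcomes given treatment `x'` in the interpolating population. -/
noncomputable def armKernel (θ c t : ℝ) (η : Kernel W (ℝ × Bool)) (x' x : Bool) : Kernel W ℝ :=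
  if x' = x then outcomeKernel η x
  -- An `NNReal`-valued density makes the kernel s-finite, as products of kernels require.
  else (outcomeKernel η x).withDensity fun w y =>
    ((((boundDensity θ c t (η w) x y - propensity (η w) x) /
      (1 - propensity (η w) x)).toNNReal : NNReal) : ℝ≥0∞)

instance (θ c t : ℝ) (η : Kernel W (ℝ × Bool)) (x' x : Bool) :
    IsSFiniteKernel (armKernel θ c t η x' x) := by
  unfold armKernel
  split_ifs <;> infer_instance

lemma armKernel_apply (θ c t : ℝ) (η : Kernel W (ℝ × Bool)) (x' x : Bool) (w : W) :
    armKernel θ c t η x' x w = witnessArm (η w) (boundDensity θ c t (η w)) x' x := by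
  unfold armKernel witnessArm
  split_ifs
  · rfl
  · have hm : Measurable (Function.uncurry fun w y =>
        ((((boundDensity θ c t (η w) x y - propensity (η w) x) /
          (1 - propensity (η w) x)).toNNReal : NNReal) : ℝ≥0∞)) := by
      have h1 := measurable_boundDensity θ c t η x
      have h2 : Measurable fun z : W × ℝ => propensity (η z.1) x :=
        (measurable_propensity η x).comp measurable_fst
      exact ((h1.sub h2).div (measurable_const.sub h2)).real_toNNReal.coe_nnreal_ennreal
    rw [Kernel.withDensity_apply _ hm]
    rfl

lemma measurable_witness (θ c t : ℝ) (η : Kernel W (ℝ × Bool)) :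
    Measurable fun w => witness (η w) (boundDensity θ c t (η w)) := by
  have harm : ∀ x', Measurable fun w =>
      armLaw (witnessArm (η w) (boundDensity θ c t (η w)) x') x' := fun x' => by
    have := ((armKernel θ c t η x' true ×ₖ armKernel θ c t η x' false).map
      fun z => ((fun b => bif b then z.1 else z.2, x') : Latent)).measurable
    convert this using 2 with w
    rw [Kernel.map_apply _ (measurable_arm x'), Kernel.prod_apply, armKernel_apply,
      armKernel_apply]
    rfl
  refine Measure.measurable_of_measurable_coe _ fun s hs => ?_
  simp only [witness, populationLaw, Measure.add_apply, Measure.smul_apply, smul_eq_mul]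
  have h := fun x' => ((measurable_propensity η x').ennreal_ofReal).mul
    ((Measure.measurable_coe hs).comp (harm x'))
  exact (h true).add (h false)

/-- The population that interpolates between the contracted bounds for covariates in `S`, and
agrees with `κ` elsewhere. -/
noncomputable def boundKernel (θ c t : ℝ) (κ : Kernel W Latent) (S : Set W)
    (hS : MeasurableSet S) : Kernel W Latent :=
  open Classical in
  Kernel.piecewise hS ⟨fun w => witness (obsLaw (κ w)) (boundDensity θ c t (obsLaw (κ w))), by
    simpa only [Kernel.map_apply _ measurable_observe, obsLaw] using
      measurable_witness θ c t (κ.map observe)⟩ κ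

lemma boundKernel_apply_of_mem {θ c t : ℝ} {κ : Kernel W Latent} {S : Set W}
    (hS : MeasurableSet S) {w : W} (hw : w ∈ S) : boundKernel θ c t κ S hS w =
      witness (obsLaw (κ w)) (boundDensity θ c t (obsLaw (κ w))) := by
  classical
  rw [boundKernel, Kernel.piecewise_apply, if_pos hw]
  rfl

lemma boundKernel_apply_of_notMem {θ c t : ℝ} {κ : Kernel W Latent} {S : Set W}
    (hS : MeasurableSet S) {w : W} (hw : w ∉ S) : boundKernel θ c t κ S hS w = κ w := by
  classical
  rw [boundKernel, Kernel.piecewise_apply, if_neg hw]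

end Kernels

/-! ### The conditional average treatment effect -/

section Cate

variable {c : ℝ}

/-- The mean of the quantile gap: the bound on `E(Y_x | W = w) - E(Y_{1-x} | W = w)`. -/
noncomputable def gapBound (c : ℝ) (q : Measure (ℝ × Bool)) (x : Bool) : EReal :=
  extMean (volume.restrict (Ioo (0 : ℝ) 1)) (quantileGap c q x)

lemma extMean_effect_le {ν : Measure Latent} [IsProbabilityMeasure ν] (hc : 0 ≤ c)
    (hreg : RegularAt ν) (hq : RegularObserved (obsLaw ν)) (hdep : ∀ x, CDependentAt c ν x)
    (x : Bool) (hex : ExtMeanExists ν fun ω => ((ω.1 x - ω.1 (!x) : ℝ) : EReal)) :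
    extMean ν (fun ω => ((ω.1 x - ω.1 (!x) : ℝ) : EReal)) ≤ gapBound c (obsLaw ν) x := by
  have h2 := hex.2
  simp only [toENNReal_neg_coe, EReal.real_coe_toENNReal] at h2
  simp only [extMean, gapBound, toENNReal_neg_coe, EReal.real_coe_toENNReal]
  exact coe_ennreal_sub_le_sub (lintegral_effect_add_le hc hreg hq hdep x) h2
    (hq.extMean_quantileGap hc x).2.1

lemma neg_effect {ω : Latent} : ((ω.1 false - ω.1 (!false) : ℝ) : EReal) =
    -((ω.1 true - ω.1 false : ℝ) : EReal) := by
  rw [← EReal.coe_neg, neg_sub]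
  rfl

lemma cate_mem_Icc {ν : Measure Latent} [IsProbabilityMeasure ν] (hc : 0 ≤ c)
    (hreg : RegularAt ν) (hq : RegularObserved (obsLaw ν)) (hdep : ∀ x, CDependentAt c ν x)
    (hex : CateExists ν) :
    cate ν ∈ Icc (cateLower c (obsLaw ν)) (cateUpper c (obsLaw ν)) := by
  obtain ⟨hE, heq⟩ := extMean_coe_sub (hex.1 true) (hex.1 false) hex.2.1 hex.2.2
  have h1 := extMean_effect_le hc hreg hq hdep true hE
  have h0 := extMean_effect_le hc hreg hq hdep false (by simpa only [neg_effect] using hE.neg)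
  simp only [neg_effect] at h0
  rw [extMean_neg hE] at h0
  rw [cate, potMean, potMean, heq, hq.cateLower_eq hc]
  exact ⟨EReal.neg_le_of_neg_le h0, h1⟩

lemma tendsto_gapMean {q : Measure (ℝ × Bool)} (hq : RegularObserved q) (hc : 0 ≤ c) (x : Bool) :
    Tendsto (fun n => (gapMean (contraction n) c q x : EReal)) atTop (𝓝 (gapBound c q x)) :=
  (hq.extMean_quantileGap hc x).2.2

lemma monotone_gapMean {q : Measure (ℝ × Bool)} (hq : RegularObserved q) (hc : 0 ≤ c) (x : Bool) :
    Monotone fun n => gapMean (contraction n) c q x := fun i j hij =>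
  setIntegral_mono_on ((hq.integrableOn_shrunkUpper hc (contraction_mem i) x).1.sub
      (hq.integrableOn_shrunkLower hc (contraction_mem i) (!x)).1)
    ((hq.integrableOn_shrunkUpper hc (contraction_mem j) x).1.sub
      (hq.integrableOn_shrunkLower hc (contraction_mem j) (!x)).1) measurableSet_Ioo
    fun _ hτ => sub_le_sub (hq.monotone_shrunkUpper hc x hτ hij)
      (hq.antitone_shrunkLower hc _ hτ hij)

/-- Every value strictly between the limits is an interpolation between approximate bounds. -/
lemma exists_interpolation {a b : ℕ → ℝ} {A B e : EReal}
    (ha : Tendsto (fun n => (a n : EReal)) atTop (𝓝 A))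
    (hb : Tendsto (fun n => (b n : EReal)) atTop (𝓝 B)) (he : e ∈ Ioo (-B) A) :
    ∃ n, ∃ t ∈ Icc (0 : ℝ) 1, ((t * a n - (1 - t) * b n : ℝ) : EReal) = e := by
  induction e with
  | bot => exact absurd he.1 not_lt_bot
  | top => exact absurd he.2 not_top_lt
  | coe e =>
    have hB : ((-e : ℝ) : EReal) < B := by
      rw [EReal.coe_neg]
      exact EReal.neg_lt_comm.1 he.1
    obtain ⟨n, h1, h2⟩ := ((ha.eventually (lt_mem_nhds he.2)).and
      (hb.eventually (lt_mem_nhds hB))).exists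
    rw [EReal.coe_lt_coe_iff] at h1 h2
    have hpos : 0 < a n + b n := by linarith
    -- The solution `t` of `t * a n - (1 - t) * b n = e`; it lies in `[0, 1]` because `-b n < e < a
    -- n`.
    refine ⟨n, (e + b n) / (a n + b n), ⟨div_nonneg (by linarith) hpos.le,
      (div_le_one hpos).2 (by linarith)⟩, ?_⟩
    rw [EReal.coe_eq_coe_iff]
    field_simp
    ring

lemma cate_witness {q : Measure (ℝ × Bool)} (hq : RegularObserved q) (hc : 0 ≤ c) {θ t : ℝ}
    (hθ : θ ∈ Ico (0 : ℝ) 1) (ht : t ∈ Icc (0 : ℝ) 1) :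
    CateExists (witness q (boundDensity θ c t q)) ∧
      cate (witness q (boundDensity θ c t q)) =
        ((t * gapMean θ c q true - (1 - t) * gapMean θ c q false : ℝ) : EReal) := by
  have h := hq.integral_potential_boundDensity hc hθ ht
  have hmean := fun x => extMean_coe (h x).1
  refine ⟨⟨fun x => extMeanExists_coe (h x).1, ?_, ?_⟩, ?_⟩
  · simp [potMean, hmean]
  · simp [potMean, hmean]
  · rw [cate, potMean, potMean, hmean, hmean, ← EReal.coe_sub, ← integral_sub (h true).1
      (h false).1, hq.integral_effect_witness hc hθ ht]

end Cate

/-! ### Populations and the average treatment effect -/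

section Ate

variable {K : ℕ} {μ : Measure (Fin K → ℝ)} {κ : Kernel (Fin K → ℝ) Latent} {c : ℝ}

lemma ae_cateLower_eq (hreg : ∀ w ∈ μ.support, RegularObserved (obsLaw (κ w))) (hc : 0 ≤ c) :
    (fun w => -gapBound c (obsLaw (κ w)) false) =ᵐ[μ] fun w => cateLower c (obsLaw (κ w)) := by
  filter_upwards [Measure.support_mem_ae (μ := μ)] with w hw
  exact ((hreg w hw).cateLower_eq hc).symm

variable [IsMarkovKernel κ]

lemma measurable_effect : Measurable fun z : (Fin K → ℝ) × Latent => z.2.1 true - z.2.1 false :=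
  ((measurable_potential true).comp measurable_snd).sub
    ((measurable_potential false).comp measurable_snd)

section

variable (hreg : ∀ w ∈ μ.support, RegularObserved (obsLaw (κ w))) (hc : 0 ≤ c)
include hreg hc

lemma compatible_boundKernel {θ t : ℝ} (hθ : θ ∈ Ico (0 : ℝ) 1) (ht : t ∈ Icc (0 : ℝ) 1)
    {Q : (Fin K → ℝ) → Measure (ℝ × Bool)} (hQ : ∀ w, Q w = obsLaw (κ w)) :
    Compatible c μ Q (boundKernel θ c t κ μ.support Measure.isClosed_support.measurableSet) := by
  have happly := fun w (hw : w ∈ μ.support) => boundKernel_apply_of_mem (θ := θ) (c := c) (t := t)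
    (κ := κ) Measure.isClosed_support.measurableSet hw
  refine ⟨⟨fun w => ?_⟩, fun w hw => ?_, fun w hw => ?_⟩
  · by_cases hw : w ∈ μ.support
    · rw [happly w hw]
      exact isProbabilityMeasure_witness (hreg w hw)
        ((hreg w hw).admissible_boundDensity hc hθ ht)
    · rw [boundKernel_apply_of_notMem _ hw]
      infer_instance
  · have hk := (hreg w hw).admissible_boundDensity hc hθ ht
    rw [happly w hw]
    exact ⟨regularAt_witness (hreg w hw) hk, cDependentAt_witness (hreg w hw) hk⟩
  · rw [happly w hw, hQ, obsLaw_witness (hreg w hw)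
      ((hreg w hw).admissible_boundDensity hc hθ ht)]

variable [IsProbabilityMeasure μ]
  (hmom : ∀ x : Bool, ∫⁻ w, ∫⁻ y, ‖y‖ₑ ∂(outcomeLaw (obsLaw (κ w)) x) ∂μ < ⊤)
include hmom

lemma integrable_effect_boundKernel {θ t : ℝ} (hθ : θ ∈ Ico (0 : ℝ) 1)
    (ht : t ∈ Icc (0 : ℝ) 1) :
    Integrable (fun z : (Fin K → ℝ) × Latent => z.2.1 true - z.2.1 false)
      (μ.compProd (boundKernel θ c t κ μ.support Measure.isClosed_support.measurableSet)) := by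
  have := (compatible_boundKernel hreg hc hθ ht fun _ => rfl).1
  refine ⟨measurable_effect.aestronglyMeasurable, ?_⟩
  rw [HasFiniteIntegral, Measure.lintegral_compProd measurable_effect.enorm]
  set C := ENNReal.ofReal (1 - θ)⁻¹
  have hbound : ∀ᵐ w ∂μ, ∫⁻ ω : Latent, ‖ω.1 true - ω.1 false‖ₑ
      ∂(boundKernel θ c t κ μ.support Measure.isClosed_support.measurableSet w) ≤
      C * ∫⁻ y, ‖y‖ₑ ∂(outcomeLaw (obsLaw (κ w)) true) +
        C * ∫⁻ y, ‖y‖ₑ ∂(outcomeLaw (obsLaw (κ w)) false) := by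
    filter_upwards [Measure.support_mem_ae (μ := μ)] with w hw
    rw [boundKernel_apply_of_mem _ hw]
    have h := (hreg w hw).lintegral_enorm_potential_le hc hθ ht
    refine le_trans ?_ (add_le_add (h true) (h false))
    rw [← lintegral_add_left (measurable_potential true).enorm]
    exact lintegral_mono fun ω => enorm_sub_le
  refine (lintegral_mono_ae hbound).trans_lt ?_
  have hm : ∀ x, Measurable fun w => ∫⁻ y, ‖y‖ₑ ∂(outcomeLaw (obsLaw (κ w)) x) := fun x => by
    have := (measurable_outcomeLaw (κ.map observe) x)
    simp only [Kernel.map_apply _ measurable_observe] at this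
    exact (Measure.measurable_lintegral measurable_enorm).comp this
  rw [lintegral_add_left ((hm true).const_mul C), lintegral_const_mul _ (hm true),
    lintegral_const_mul _ (hm false)]
  exact ENNReal.add_lt_top.2 ⟨ENNReal.mul_lt_top ENNReal.ofReal_lt_top (hmom true),
    ENNReal.mul_lt_top ENNReal.ofReal_lt_top (hmom false)⟩

/-- The integrand is almost everywhere the conditional mean of an integrable effect, so Fubini
supplies its measurability in `w` and its integrability at once. -/
lemma integrable_interpolation {θ t : ℝ} (hθ : θ ∈ Ico (0 : ℝ) 1) (ht : t ∈ Icc (0 : ℝ) 1) :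
    Integrable (fun w => t * gapMean θ c (obsLaw (κ w)) true -
        (1 - t) * gapMean θ c (obsLaw (κ w)) false) μ ∧
      ∫ z : (Fin K → ℝ) × Latent, (z.2.1 true - z.2.1 false)
        ∂(μ.compProd (boundKernel θ c t κ μ.support Measure.isClosed_support.measurableSet)) =
      ∫ w, (t * gapMean θ c (obsLaw (κ w)) true -
        (1 - t) * gapMean θ c (obsLaw (κ w)) false) ∂μ := by
  have := (compatible_boundKernel hreg hc hθ ht fun _ => rfl).1
  have hint := integrable_effect_boundKernel hreg hc hmom hθ ht
  have hae : (fun w => ∫ ω : Latent, (ω.1 true - ω.1 false)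
      ∂(boundKernel θ c t κ μ.support Measure.isClosed_support.measurableSet w)) =ᵐ[μ]
      fun w => t * gapMean θ c (obsLaw (κ w)) true -
        (1 - t) * gapMean θ c (obsLaw (κ w)) false := by
    filter_upwards [Measure.support_mem_ae (μ := μ)] with w hw
    rw [boundKernel_apply_of_mem _ hw, (hreg w hw).integral_effect_witness hc hθ ht]
  have hmarg : Integrable (fun w => ∫ ω : Latent, (ω.1 true - ω.1 false)
      ∂(boundKernel θ c t κ μ.support Measure.isClosed_support.measurableSet w)) μ := by
    simpa using Integrable.integral_compProd (κ := Kernel.const Unit μ)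
      (η := Kernel.prodMkLeft Unit _) (a := ()) hint
  exact ⟨hmarg.congr hae,
    (Measure.integral_compProd hint).trans (integral_congr_ae hae)⟩

/-- The endpoints `t = 0` and `t = 1` of the interpolation isolate the two gap means. -/
lemma integrable_gapMean {θ : ℝ} (hθ : θ ∈ Ico (0 : ℝ) 1) (x : Bool) :
    Integrable (fun w => gapMean θ c (obsLaw (κ w)) x) μ := by
  cases x
  · simpa using (integrable_interpolation hreg hc hmom hθ (left_mem_Icc.2 zero_le_one)).1.neg
  · simpa using (integrable_interpolation hreg hc hmom hθ (right_mem_Icc.2 zero_le_one)).1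

/-- Monotone convergence over the covariate, on top of the one over quantile levels that defines the
limit at each `w`. -/
lemma extMean_gapBound (x : Bool) :
    AEMeasurable (fun w => gapBound c (obsLaw (κ w)) x) μ ∧
      ∫⁻ w, (-gapBound c (obsLaw (κ w)) x).toENNReal ∂μ ≠ ⊤ ∧
      Tendsto (fun n => ((∫ w, gapMean (contraction n) c (obsLaw (κ w)) x ∂μ : ℝ) : EReal)) atTop
        (𝓝 (extMean μ fun w => gapBound c (obsLaw (κ w)) x)) := by
  refine extMean_of_monotone
    (fun n => integrable_gapMean hreg hc hmom (contraction_mem n) x) ?_ ?_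
  · filter_upwards [Measure.support_mem_ae (μ := μ)] with w hw
    exact monotone_gapMean (hreg w hw) hc x
  · filter_upwards [Measure.support_mem_ae (μ := μ)] with w hw
    exact tendsto_gapMean (hreg w hw) hc x

lemma extMeanExists_gapBound (x : Bool) :
    ExtMeanExists μ fun w => gapBound c (obsLaw (κ w)) x :=
  ⟨(extMean_gapBound hreg hc hmom x).1, Or.inr (extMean_gapBound hreg hc hmom x).2.1⟩

end

variable [IsProbabilityMeasure μ]

lemma extMean_compProd_effect_le
    (hreg : ∀ w ∈ μ.support, RegularObserved (obsLaw (κ w))) (hc : 0 ≤ c)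
    (hmom : ∀ x : Bool, ∫⁻ w, ∫⁻ y, ‖y‖ₑ ∂(outcomeLaw (obsLaw (κ w)) x) ∂μ < ⊤)
    (hA : MaintainedAssumptions c μ κ) (x : Bool)
    (hex : ExtMeanExists (μ.compProd κ)
      fun z : (Fin K → ℝ) × Latent => ((z.2.1 x - z.2.1 (!x) : ℝ) : EReal)) :
    extMean (μ.compProd κ) (fun z => ((z.2.1 x - z.2.1 (!x) : ℝ) : EReal)) ≤
      extMean μ fun w => gapBound c (obsLaw (κ w)) x := by
  have h2 := hex.2
  have hbound := extMean_gapBound hreg hc hmom x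
  have hm : Measurable fun z : (Fin K → ℝ) × Latent => z.2.1 x - z.2.1 (!x) :=
    ((measurable_potential x).comp measurable_snd).sub
      ((measurable_potential (!x)).comp measurable_snd)
  have hbneg : AEMeasurable (fun w => -gapBound c (obsLaw (κ w)) x) μ := hbound.1.neg
  have hneg : Measurable fun z : (Fin K → ℝ) × Latent => -(z.2.1 x - z.2.1 (!x)) := hm.neg
  simp only [toENNReal_neg_coe, EReal.real_coe_toENNReal] at h2
  simp only [extMean, toENNReal_neg_coe, EReal.real_coe_toENNReal]
  refine coe_ennreal_sub_le_sub ?_ h2 hbound.2.1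
  rw [Measure.lintegral_compProd hm.ennreal_ofReal,
    Measure.lintegral_compProd hneg.ennreal_ofReal,
    ← lintegral_add_right' _ hbneg.ereal_toENNReal,
    ← lintegral_add_right' _ hbound.1.ereal_toENNReal]
  refine lintegral_mono_ae ?_
  filter_upwards [Measure.support_mem_ae (μ := μ)] with w hw
  -- The conditional effect may fail to have a mean at this `w`; the subtraction-free inequality
  -- holds regardless.
  exact add_toENNReal_neg_sub_le
    (lintegral_effect_add_le hc (hA w hw).1 (hreg w hw) (hA w hw).2 x)
    ((hreg w hw).extMean_quantileGap hc x).2.1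

end Ate

end SensitivityBounds

/-! ### The bounds and their sharpness. -/

theorem mainTheorem4 {K : ℕ}
    (μ : Measure (Fin K → ℝ)) [IsProbabilityMeasure μ]
    (κ : Kernel (Fin K → ℝ) Latent) [IsMarkovKernel κ]
    (c : ℝ) (hc : c ∈ Icc (0 : ℝ) 1)
    (hA : MaintainedAssumptions c μ κ)
    (Q : (Fin K → ℝ) → Measure (ℝ × Bool)) (hQ : ∀ w, Q w = obsLaw (κ w))
    (hmom : ∀ w ∈ μ.support, ∀ x : Bool, ∫⁻ y, ‖y‖ₑ ∂(outcomeLaw (Q w) x) < ⊤) :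
    (∀ w ∈ μ.support,
      ExtMeanExists (volume.restrict (Ioo (0 : ℝ) 1)) (cqteLower c (Q w)) ∧
      ExtMeanExists (volume.restrict (Ioo (0 : ℝ) 1)) (cqteUpper c (Q w)) ∧
      (CateExists (κ w) → cate (κ w) ∈ Icc (cateLower c (Q w)) (cateUpper c (Q w))) ∧
      Ioo (cateLower c (Q w)) (cateUpper c (Q w)) ⊆ cateIdentifiedSet c μ Q w) ∧
    ((∀ x : Bool, ∫⁻ w, ∫⁻ y, ‖y‖ₑ ∂(outcomeLaw (Q w) x) ∂μ < ⊤) →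
      ExtMeanExists μ (fun w => cateLower c (Q w)) ∧
      ExtMeanExists μ (fun w => cateUpper c (Q w)) ∧
      (AteExists μ κ → ate μ κ ∈ Icc (ateLower c μ Q) (ateUpper c μ Q)) ∧
      Ioo (ateLower c μ Q) (ateUpper c μ Q) ⊆ ateIdentifiedSet c μ Q) := by
  obtain rfl : Q = fun w => obsLaw (κ w) := funext hQ
  have hreg : ∀ w ∈ μ.support, RegularObserved (obsLaw (κ w)) := fun w hw =>
    (hA w hw).1.regularObserved (hmom w hw)
  have hS := (Measure.isClosed_support (μ := μ)).measurableSet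
  refine ⟨fun w hw => ⟨(hreg w hw).extMeanExists_cqteLower hc.1,
    (hreg w hw).extMeanExists_cqteUpper hc.1,
    cate_mem_Icc hc.1 (hA w hw).1 (hreg w hw) (hA w hw).2, fun e he => ?_⟩, fun hmom2 => ?_⟩
  · rw [(hreg w hw).cateLower_eq hc.1] at he
    obtain ⟨n, t, ht, heq⟩ := exists_interpolation (tendsto_gapMean (hreg w hw) hc.1 true)
      (tendsto_gapMean (hreg w hw) hc.1 false) he
    -- The `n` and `t` chosen for this `w` are used at every covariate in the support; only the
    -- value at `w` matters.
    refine ⟨boundKernel (contraction n) c t κ μ.support hS,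
      compatible_boundKernel hreg hc.1 (contraction_mem n) ht fun _ => rfl, ?_⟩
    rw [boundKernel_apply_of_mem hS hw, ← heq]
    exact cate_witness (hreg w hw) hc.1 (contraction_mem n) ht
  · have hlow := ae_cateLower_eq hreg hc.1
    have hE := extMeanExists_gapBound hreg hc.1 hmom2
    have hlower : ateLower c μ (fun w => obsLaw (κ w)) =
        -extMean μ fun w => gapBound c (obsLaw (κ w)) false := by
      rw [← extMean_neg (hE false)]
      exact (extMean_congr_ae hlow).symm
    refine ⟨(hE false).neg.congr_ae hlow, hE true, fun hex => ?_, fun e he => ?_⟩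
    · have h1 := extMean_compProd_effect_le hreg hc.1 hmom2 hA true hex
      have h0 := extMean_compProd_effect_le hreg hc.1 hmom2 hA false
        (by simpa only [neg_effect, effect] using hex.neg)
      simp only [neg_effect] at h0
      rw [extMean_neg (show ExtMeanExists (μ.compProd κ)
        (fun z => ((z.2.1 true - z.2.1 false : ℝ) : EReal)) from hex)] at h0
      rw [hlower]
      exact ⟨EReal.neg_le_of_neg_le h0, h1⟩
    · rw [hlower] at he
      -- The interpolation is applied to means already integrated over `W`, so a single `n` and `t`
      -- serve all covariates.
      obtain ⟨n, t, ht, heq⟩ := exists_interpolation (extMean_gapBound hreg hc.1 hmom2 true).2.2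
        (extMean_gapBound hreg hc.1 hmom2 false).2.2 he
      have hint := integrable_effect_boundKernel hreg hc.1 hmom2 (contraction_mem n) ht
      have hgap := integrable_gapMean hreg hc.1 hmom2 (contraction_mem n)
      refine ⟨boundKernel (contraction n) c t κ μ.support hS,
        compatible_boundKernel hreg hc.1 (contraction_mem n) ht fun _ => rfl,
        extMeanExists_coe hint, ?_⟩
      rw [← heq]
      refine (extMean_coe hint).trans ?_
      rw [(integrable_interpolation hreg hc.1 hmom2 (contraction_mem n) ht).2,
        integral_sub ((hgap true).const_mul _) ((hgap false).const_mul _), integral_const_mul,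
        integral_const_mul]
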